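/- For positive integers $m,n$ let $K_m\times P_n$ and $P_m\times P_n$ be the Cartesian products of the complete graph $K_m$, respectively the path $P_m$, with the path $P_n$, on the common vertex set $\{v_{i,j}:1\le i\le m,\ 1\le j\le n\}$; let $I_j=\{v_{1,j},\dots,v_{m,j}\}$ be the $j$-th column. A connected set of a graph $G$ is a nonempty vertex set inducing a connected subgraph, and $N(G)$ is the number of connected sets of $G$. Let $\mathcal C_{m,n}$ be the set of connected sets of $K_m\times P_n$ that meet every column, and let $\mathcal C'_{m,n}$ be the set of those $C\in\mathcal C_{m,n}$ that are not connected sets of $P_m\times P_n$. For a nonempty vertex set $X$ let $N(K_m\times P_n;X)$ (respectively $N'(K_m\times P_n;X)$) be the number of $C\in\mathcal C_{m,n}$ (respectively $C\in\mathcal C'_{m,n}$) such that $C\cap I_j=X\cap I_j$ for every $j$ with $X\cap I_j\ne\emptyset$. Let $$T=\begin{bmatrix}1&3&3&1\\2&5&4&1\\3&6&4&1\\4&6&4&1\end{bmatrix},\qquad \mathbf u=\begin{bmatrix}\binom41&\binom42&\binom43&\binom44\end{bmatrix},$$ and for $k\ge1$ let $N_{4,k}=\mathbf u\cdot T^{k-1}\mathbf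 1$ and let $f_{4,k}^i$ be the $i$-th entry of $T^{k-1}\mathbf 1$ ($1\le i\le 4$). For $n\ge1$ put $$\begin{aligned} &a_n^1=N'(K_4\times P_n;\{v_{1,n}\}),\quad a_n^2=N'(K_4\times P_n;\{v_{2,n}\}),\\ &b_n^1=N'(K_4\times P_n;\{v_{1,n},v_{2,n}\}),\quad b_n^2=N'(K_4\times P_n;\{v_{2,n},v_{3,n}\}),\\ &b_n^4=N'(K_4\times P_n;\{v_{1,n},v_{3,n}\}),\quad b_n^6=N'(K_4\times P_n;\{v_{1,n},v_{4,n}\}),\\ &c_n^1=N'(K_4\times P_n;\{v_{1,n},v_{2,n},v_{3,n}\}),\quad c_n^3=N'(K_4\times P_n;\{v_{1,n},v_{2,n},v_{4,n}\}),\quad g_n=N'(K_4\times P_n;I_n), \end{aligned}$$ and for $n\ge2$ put $$\begin{aligned} r_n&=N'(K_4\times P_n;\{v_{1,n},v_{2,n},v_{3,n},v_{1,n-1},v_{3,n-1}\}),\\ t_n&=N'(K_4\times P_n;\{v_{1,n},v_{2,n},v_{3,n},v_{1,n-1},v_{3,n-1},v_{4,n-1}\}),\\ k_n&=N'(K_4\times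 P_n;I_n\cup\{v_{1,n-1},v_{4,n-1}\}). \end{aligned}$$ **Theorem.** For every positive integer $n$, $$N(P_4\times P_n)=\sum_{k=1}^n\bigl(N_{4,k}-|\mathcal C'_{4,k}|\bigr)(n-k+1).$$ Here, for every $k\ge1$, $|\mathcal C_{4,k}|=N_{4,k}$; $N(K_4\times P_k;X)=f_{4,k}^{|X|}$ for every nonempty $X\subseteq I_k$; and $$|\mathcal C_{4,k}'|=2a_k^1+2a_k^2+2b_k^1+b_k^2+2b_k^4+b_k^6+2c_k^1+2c_k^3+g_k,$$ where the sequences are determined by the initial values $a_1^1=a_1^2=b_1^1=b_1^2=c_1^1=g_1=0$, $b_1^4=b_1^6=c_1^3=1$, $r_2=t_2=k_2=0$ and the following recurrences. For $n\ge3$, $$\begin{aligned} r_n&=a_{n-2}^1+a_{n-2}^2+2b_{n-2}^1+b_{n-2}^2+b_{n-2}^6+r_{n-1}+2c_{n-2}^1+c_{n-2}^3+t_{n-1}+g_{n-2},\\ t_n&=2a_{n-2}^1+a_{n-2}^2+2b_{n-2}^1+b_{n-2}^2+b_{n-2}^4+r_{n-1}+k_{n-1}+2c_{n-2}^1+2t_{n-1}+g_{n-2},\\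 k_n&=2a_{n-2}^1+2b_{n-2}^1+2b_{n-2}^4+k_{n-1}+2c_{n-2}^1+2t_{n-1}+g_{n-2}, \end{aligned}$$ and for $n\ge2$, $$\begin{aligned} a_n^1&=a_{n-1}^1+b_{n-1}^1+b_{n-1}^4+b_{n-1}^6+c_{n-1}^1+2c_{n-1}^3+g_{n-1},\\ a_n^2&=a_{n-1}^2+b_{n-1}^1+b_{n-1}^2+b_{n-1}^4+2c_{n-1}^1+c_{n-1}^3+g_{n-1},\\ b_n^1&=a_{n-1}^1+a_{n-1}^2+b_{n-1}^1+b_{n-1}^2+2b_{n-1}^4+b_{n-1}^6+2c_{n-1}^1+2c_{n-1}^3+g_{n-1},\\ b_n^2&=2a_{n-1}^2+2b_{n-1}^1+b_{n-1}^2+2b_{n-1}^4+2c_{n-1}^1+2c_{n-1}^3+g_{n-1},\\ b_n^4&=2f_{4,n-1}^1+4f_{4,n-1}^2+b_{n-1}^4+2f_{4,n-1}^3+c_{n-1}^1+c_{n-1}^3+g_{n-1},\\ b_n^6&=2f_{4,n-1}^1+4f_{4,n-1}^2+b_{n-1}^6+2f_{4,n-1}^3+2c_{n-1}^3+g_{n-1},\\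 c_n^1&=a_{n-1}^1+2a_{n-1}^2+2b_{n-1}^1+b_{n-1}^2+b_{n-1}^4+b_{n-1}^6+r_n+2c_{n-1}^1+c_{n-1}^3+t_n+g_{n-1},\\ c_n^3&=3f_{4,n-1}^1+4f_{4,n-1}^2+b_{n-1}^4+b_{n-1}^6+f_{4,n-1}^3+c_{n-1}^1+2c_{n-1}^3+g_{n-1},\\ g_n&=2a_{n-1}^1+2a_{n-1}^2+2b_{n-1}^1+b_{n-1}^2+2r_n+k_n+2c_{n-1}^1+2t_n+g_{n-1}. \end{aligned}$$ -/

import Mathlib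

open scoped Matrix

namespace GridConn

/-- The connected sets of `G`: the vertex sets inducing a connected subgraph.
(`SimpleGraph.Connected` includes non-emptiness, so the empty set is excluded.) -/
def connSets {V : Type*} (G : SimpleGraph V) : Set (Set V) :=
  {C | (G.induce C).Connected}

/-- `N(G)`, the number of connected sets of a (finite) graph `G`. -/
noncomputable def numConn {V : Type*} (G : SimpleGraph V) : ℕ :=
  (connSets G).ncard

/-- `K_m × P_n`. -/
abbrev KP (m n : ℕ) : SimpleGraph (Fin m × Fin n) :=
  (⊤ : SimpleGraph (Fin m)).boxProd (SimpleGraph.pathGraph n)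

/-- The grid graph `P_m × P_n`. -/
abbrev PP (m n : ℕ) : SimpleGraph (Fin m × Fin n) :=
  (SimpleGraph.pathGraph m).boxProd (SimpleGraph.pathGraph n)

/-- The set `{v_{i,j} : i ∈ S}` inside the `j`-th column, where rows and columns are
labelled from `1`: the pair `(p, q)` is the vertex `v_{p+1,q+1}`. -/
def inColumn (m n j : ℕ) (S : Set ℕ) : Set (Fin m × Fin n) :=
  {v | (v.2 : ℕ) + 1 = j ∧ (v.1 : ℕ) + 1 ∈ S}

/-- The `j`-th column `I_j`. -/
def column (m n j : ℕ) : Set (Fin m × Fin n) := {v | (v.2 : ℕ) + 1 = j}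

/-- `C` contains at least one vertex of each column. -/
def MeetsColumns {m n : ℕ} (C : Set (Fin m × Fin n)) : Prop :=
  ∀ j ∈ Finset.Icc 1 n, (C ∩ column m n j).Nonempty

/-- `𝒞_{m,n}`: connected sets of `K_m × P_n` that meet every column. -/
def fullSets (m n : ℕ) : Set (Set (Fin m × Fin n)) :=
  {C | C ∈ connSets (KP m n) ∧ MeetsColumns C}

/-- `𝒞'_{m,n}`: sets that meet every column and are connected in `K_m × P_n`, but not
in `P_m × P_n`. -/
def badSets (m n : ℕ) : Set (Set (Fin m × Fin n)) :=
  {C | C ∈ connSets (KP m n) \ connSets (PP m n) ∧ MeetsColumns C}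

/-- `C ∩ I_j = X ∩ I_j` for every column `I_j` that `X` meets. -/
def AgreesWith {m n : ℕ} (C X : Set (Fin m × Fin n)) : Prop :=
  ∀ j ∈ Finset.Icc 1 n, (X ∩ column m n j).Nonempty → C ∩ column m n j = X ∩ column m n j

/-- `N(K_m × P_n; X)`. -/
noncomputable def fullCount (m n : ℕ) (X : Set (Fin m × Fin n)) : ℕ :=
  {C | C ∈ fullSets m n ∧ AgreesWith C X}.ncard

/-- `N'(K_m × P_n; X)`. -/
noncomputable def badCount (m n : ℕ) (X : Set (Fin m × Fin n)) : ℕ :=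
  {C | C ∈ badSets m n ∧ AgreesWith C X}.ncard

/-- The `4 × 4` transfer matrix. -/
def transfer : Matrix (Fin 4) (Fin 4) ℕ :=
  !![1, 3, 3, 1;
     2, 5, 4, 1;
     3, 6, 4, 1;
     4, 6, 4, 1]

/-- `f_{4,k}^i`, the `i`-th entry of `T^(k-1) 1`, for `k ≥ 1` and `1 ≤ i ≤ 4`; the index
`p : Fin 4` stands for `i = p + 1`. -/
def f (k : ℕ) : Fin 4 → ℕ := (transfer ^ (k - 1)) *ᵥ (fun _ => 1)

/-- `N_{4,k} = u · T^(k-1) 1`, for `k ≥ 1`. -/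
def N4 (k : ℕ) : ℕ :=
  ![Nat.choose 4 1, Nat.choose 4 2, Nat.choose 4 3, Nat.choose 4 4] ⬝ᵥ
    ((transfer ^ (k - 1)) *ᵥ (fun _ => 1))

/-- `N'(K_4 × P_n; {v_{i,n} : i ∈ S})`. -/
noncomputable def lastBad (n : ℕ) (S : Set ℕ) : ℕ := badCount 4 n (inColumn 4 n n S)

/-- `N'(K_4 × P_n; {v_{i,n} : i ∈ S} ∪ {v_{i,n-1} : i ∈ T})`, for `n ≥ 2`. -/
noncomputable def lastTwoBad (n : ℕ) (S T : Set ℕ) : ℕ :=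
  badCount 4 n (inColumn 4 n n S ∪ inColumn 4 n (n - 1) T)

/-! The nine sequences, and the three auxiliary ones. -/

noncomputable def a1 (n : ℕ) : ℕ := lastBad n {1}
noncomputable def a2 (n : ℕ) : ℕ := lastBad n {2}
noncomputable def b1 (n : ℕ) : ℕ := lastBad n {1, 2}
noncomputable def b2 (n : ℕ) : ℕ := lastBad n {2, 3}
noncomputable def b4 (n : ℕ) : ℕ := lastBad n {1, 3}
noncomputable def b6 (n : ℕ) : ℕ := lastBad n {1, 4}
noncomputable def c1 (n : ℕ) : ℕ := lastBad n {1, 2, 3}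
noncomputable def c3 (n : ℕ) : ℕ := lastBad n {1, 2, 4}
noncomputable def g (n : ℕ) : ℕ := lastBad n {1, 2, 3, 4}

noncomputable def r (n : ℕ) : ℕ := lastTwoBad n {1, 2, 3} {1, 3}
noncomputable def t (n : ℕ) : ℕ := lastTwoBad n {1, 2, 3} {1, 3, 4}
noncomputable def κ (n : ℕ) : ℕ := lastTwoBad n {1, 2, 3, 4} {1, 4}

end GridConn

open GridConn

namespace GridConn

/-! In `K_4 × P_n` every column is a clique, so a set meeting all columns is connected exactly when
consecutive columns share a row. How many columns of a given size meet a fixed column depends only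
on the size of the latter, which yields the transfer matrix (`mem_fullSets_toSet`, `card_linked`,
`cntAll_eq`).

Disconnectedness in `P_4 × P_n` is tracked by building the set column by column. A prefix matters
only through two data: whether some component has already failed to reach its last column (`Dead`),
and how the runs of that column are joined through earlier columns (`Trace`). Four rows hold at most
two runs, so the runs are either all joined or pairwise separate (`trace_dichotomy`). A prefix is
therefore joined, split or dead, and the effect of appending `Y` to a word ending in `X` is a finite
table (`bad_snoc`, `dead_snoc'`). Summing over `X` gives linear recurrences (`cntBad_succ`,
`cntDead_succ`).

For a single-run column, bad and dead coincide, so separate dead counts are needed only for two-run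
columns: up to reflection (`cnt_flip`) rows {1,3}, {1,3,4} and {1,4}. The sequences `r`, `t`, `κ`
are these counts, seen after appending a column that joins the two runs (`lastTwoBad_eq`).

Finally, the columns met by a connected set of the grid form an interval. An interval of length `k`
has `n - k + 1` positions, and each carries the connected sets that span `k` columns
(`numConn_eq_sum`). -/

/-! ### Connectedness as the absence of cuts. -/

/-- A vertex set induces a connected subgraph iff it is nonempty and cannot be cut. -/
theorem mem_connSets_iff {V : Type*} (G : SimpleGraph V) (C : Set V) :
    C ∈ connSets G ↔ C.Nonempty ∧
      ∀ S ⊆ C, (∀ u ∈ S, ∀ v ∈ C, G.Adj u v → v ∈ S) → S = ∅ ∨ S = C := by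
  constructor
  · intro h
    have h : (G.induce C).Connected := h
    obtain ⟨⟨u, hu⟩⟩ := h.nonempty
    refine ⟨⟨u, hu⟩, fun S hS hcl => ?_⟩
    rcases S.eq_empty_or_nonempty with h0 | ⟨w, hw⟩
    · exact Or.inl h0
    refine Or.inr (hS.antisymm fun v hv => ?_)
    obtain ⟨p⟩ := h.preconnected ⟨w, hS hw⟩ ⟨v, hv⟩
    have key : ∀ (x y : C), (G.induce C).Walk x y → x.1 ∈ S → y.1 ∈ S := by
      intro x y p
      induction p with
      | nil => exact id
      | cons hadj _ ih => exact fun hx => ih (hcl _ hx _ (Subtype.property _) hadj)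
    exact key _ _ p hw
  · rintro ⟨⟨u, hu⟩, h⟩
    show (G.induce C).Connected
    rw [SimpleGraph.connected_iff_exists_forall_reachable]
    refine ⟨⟨u, hu⟩, ?_⟩
    -- The component of `u` is closed under adjacency, hence is everything.
    have := h {v | ∃ hv : v ∈ C, (G.induce C).Reachable ⟨u, hu⟩ ⟨v, hv⟩}
      (fun v hv => hv.1) (by
        rintro v ⟨hv, hr⟩ w hw hadj
        refine ⟨hw, hr.trans (SimpleGraph.Adj.reachable ?_)⟩
        exact hadj)
    rcases this with h0 | h0
    · exact absurd (show u ∈ (∅ : Set V) from h0 ▸ ⟨hu, .refl _⟩) (by simp)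
    · rintro ⟨v, hv⟩
      have : v ∈ {v | ∃ hv : v ∈ C, (G.induce C).Reachable ⟨u, hu⟩ ⟨v, hv⟩} := by rw [h0]; exact hv
      exact this.2

/-! ### Vertex sets as words of binary columns. -/

/-- A column of a vertex set of `K_4 × P_n`, encoded in binary. -/
abbrev Mask := Fin 16

/-- Row `i` belongs to the column `X`. -/
def Mask.has (X : Mask) (i : Fin 4) : Bool := X.val.testBit i

theorem Mask.ext_has : ∀ {X Y : Mask}, (∀ i, X.has i = Y.has i) → X = Y := by
  decide +kernel

theorem Mask.has_and : ∀ (X Y : Mask) (i : Fin 4),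
    (X &&& Y).has i = (X.has i && Y.has i) := by
  decide +kernel

theorem Mask.exists_has : ∀ p : Fin 4 → Bool, ∃ X : Mask, ∀ i, X.has i = p i := by
  decide +kernel

theorem Mask.ne_zero_iff : ∀ X : Mask, X ≠ 0 ↔ ∃ i, X.has i = true := by
  decide +kernel

theorem Mask.has_zero : ∀ i, Mask.has 0 i = false := by decide

/-- `y` is a union of runs of consecutive rows of `X`. -/
def LC (X y : Mask) : Prop :=
  y &&& X = y ∧ ∀ i j : Fin 4, i.val + 1 = j.val → X.has i = true → X.has j = true →
    y.has i = y.has j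

instance (X y : Mask) : Decidable (LC X y) := by unfold LC; infer_instance

/-- The vertex set with given columns. -/
def toSet {n : ℕ} (c : Fin n → Mask) : Set (Fin 4 × Fin n) := {v | (c v.2).has v.1 = true}

theorem mem_toSet {n : ℕ} (c : Fin n → Mask) (i : Fin 4) (j : Fin n) :
    (i, j) ∈ toSet c ↔ (c j).has i = true := Iff.rfl

theorem toSet_bijective (n : ℕ) : Function.Bijective (toSet (n := n)) := by
  classical
  constructor
  · intro c d h
    funext j
    refine Mask.ext_has fun i => ?_
    have : (i, j) ∈ toSet c ↔ (i, j) ∈ toSet d := by rw [h]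
    rw [mem_toSet, mem_toSet] at this
    exact Bool.eq_iff_iff.2 this
  · intro C
    choose c hc using fun j : Fin n => Mask.exists_has fun i => decide ((i, j) ∈ C)
    refine ⟨c, ?_⟩
    ext ⟨i, j⟩
    simp [mem_toSet, hc]

/-- `s` is a union of components of the word `c`, read as a vertex set of `P_4 × P_n`. -/
def Cut {n : ℕ} (c s : Fin n → Mask) : Prop :=
  (∀ j, LC (c j) (s j)) ∧ ∀ i j : Fin n, i.val + 1 = j.val → s i &&& c j = s j &&& c i

/-- `c` is connected as a vertex set of `P_4 × P_n`. -/
def Joined {n : ℕ} (c : Fin n → Mask) : Prop :=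
  (∃ j, c j ≠ 0) ∧ ∀ s, Cut c s → (∀ j, s j = 0) ∨ s = c

/-- No column of `c` is empty and consecutive columns share a row. -/
def Chain {n : ℕ} (c : Fin n → Mask) : Prop :=
  (∀ j, c j ≠ 0) ∧ ∀ i j : Fin n, i.val + 1 = j.val → c i &&& c j ≠ 0

theorem toSet_nonempty {n : ℕ} (c : Fin n → Mask) : (toSet c).Nonempty ↔ ∃ j, c j ≠ 0 := by
  simp only [Mask.ne_zero_iff]
  constructor
  · rintro ⟨⟨i, j⟩, h⟩; exact ⟨j, i, h⟩
  · rintro ⟨j, i, h⟩; exact ⟨(i, j), h⟩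

theorem toSet_eq_empty {n : ℕ} (c : Fin n → Mask) : toSet c = ∅ ↔ ∀ j, c j = 0 := by
  rw [← Set.not_nonempty_iff_eq_empty, toSet_nonempty]
  push Not
  rfl

theorem meetsColumns_toSet {n : ℕ} (c : Fin n → Mask) :
    MeetsColumns (toSet c) ↔ ∀ j, c j ≠ 0 := by
  simp only [Mask.ne_zero_iff]
  constructor
  · intro h j
    obtain ⟨⟨i, j'⟩, h1, h2⟩ := h (j + 1) (by simp)
    have : j' = j := by
      have : (j' : ℕ) + 1 = j + 1 := h2
      exact Fin.ext (by omega)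
    subst this
    exact ⟨i, h1⟩
  · intro h j hj
    rw [Finset.mem_Icc] at hj
    obtain ⟨i, hi⟩ := h ⟨j - 1, by omega⟩
    refine ⟨(i, ⟨j - 1, by omega⟩), hi, ?_⟩
    show j - 1 + 1 = j
    omega

/-- Vertical edges keep the runs of each column whole, which is `LC`; horizontal edges say that two
consecutive columns agree on the rows they share, which is the link equation. -/
theorem closed_toSet_PP {n : ℕ} (c s : Fin n → Mask) :
    (toSet s ⊆ toSet c ∧ ∀ u ∈ toSet s, ∀ v ∈ toSet c, (PP 4 n).Adj u v → v ∈ toSet s) ↔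
      Cut c s := by
  constructor
  · rintro ⟨hsub, hcl⟩
    have hsub' : ∀ j i, (s j).has i = true → (c j).has i = true := fun j i h =>
      hsub (show (i, j) ∈ toSet s from h)
    refine ⟨fun j => ⟨Mask.ext_has fun i => ?_, fun i k hik hi hk => ?_⟩, fun i j hij =>
      Mask.ext_has fun k => ?_⟩
    · have := hsub' j i
      rw [Mask.has_and]
      grind
    · have h1 : (s j).has i = true → (s j).has k = true := fun h =>
        hcl (i, j) h (k, j) hk (by simp [SimpleGraph.boxProd_adj, SimpleGraph.pathGraph_adj, hik])
      have h2 : (s j).has k = true → (s j).has i = true := fun h =>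
        hcl (k, j) h (i, j) hi (by simp [SimpleGraph.boxProd_adj, SimpleGraph.pathGraph_adj, hik])
      exact Bool.eq_iff_iff.2 ⟨h1, h2⟩
    · have h1 : (s i).has k = true → (c j).has k = true → (s j).has k = true := fun h h' =>
        hcl (k, i) h (k, j) h' (by simp [SimpleGraph.boxProd_adj, SimpleGraph.pathGraph_adj, hij])
      have h2 : (s j).has k = true → (c i).has k = true → (s i).has k = true := fun h h' =>
        hcl (k, j) h (k, i) h' (by simp [SimpleGraph.boxProd_adj, SimpleGraph.pathGraph_adj, hij])
      have h3 := hsub' i k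
      have h4 := hsub' j k
      rw [Mask.has_and, Mask.has_and]
      grind
  · rintro ⟨hlc, hlink⟩
    have hsub : ∀ j i, (s j).has i = true → (c j).has i = true := by
      intro j i h
      rw [← (hlc j).1, Mask.has_and] at h
      grind
    refine ⟨fun ⟨i, j⟩ h => hsub j i h, ?_⟩
    rintro ⟨i, j⟩ hu ⟨k, l⟩ hv hadj
    rw [mem_toSet] at *
    rw [SimpleGraph.boxProd_adj] at hadj
    simp only [SimpleGraph.pathGraph_adj] at hadj
    rcases hadj with ⟨h | h, rfl⟩ | ⟨h | h, rfl⟩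
    · rw [← (hlc j).2 i k h (hsub _ _ hu) hv, hu]
    · rw [(hlc j).2 k i h hv (hsub _ _ hu), hu]
    · have := congrArg (fun m => Mask.has m i) (hlink j l h)
      simp only [Mask.has_and] at this
      grind
    · have := congrArg (fun m => Mask.has m i) (hlink l j h)
      simp only [Mask.has_and] at this
      grind

theorem toSet_mem_connSets_PP {n : ℕ} (c : Fin n → Mask) :
    toSet c ∈ connSets (PP 4 n) ↔ Joined c := by
  rw [mem_connSets_iff, toSet_nonempty, Joined]
  refine and_congr_right fun _ => ?_
  rw [(toSet_bijective n).2.forall]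
  refine forall_congr' fun s => ?_
  rw [← closed_toSet_PP, and_imp, toSet_eq_empty, (toSet_bijective n).1.eq_iff]

/-- Columns are cliques of `K_4 × P_n`, so a component contains each column entirely or not at all;
only the links between neighbouring columns remain to be checked. -/
theorem mem_fullSets_toSet {n : ℕ} (hn : 0 < n) (c : Fin n → Mask) :
    toSet c ∈ fullSets 4 n ↔ Chain c := by
  show toSet c ∈ connSets (KP 4 n) ∧ MeetsColumns (toSet c) ↔ _
  rw [meetsColumns_toSet, mem_connSets_iff, toSet_nonempty, and_comm, Chain]
  refine and_congr_right fun hne => ?_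
  constructor
  · rintro ⟨-, h⟩ a b hab h0
    -- If columns `a` and `b` share no row, no edge leaves the part up to column `a`.
    have := h {v | v ∈ toSet c ∧ v.2.val ≤ a.val} (fun v hv => hv.1) (by
      rintro ⟨i, j⟩ ⟨hu, hj⟩ ⟨k, l⟩ hv hadj
      refine ⟨hv, ?_⟩
      rw [SimpleGraph.boxProd_adj] at hadj
      simp only [SimpleGraph.pathGraph_adj] at hadj
      rcases hadj with ⟨-, rfl⟩ | ⟨h | h, rfl⟩
      · exact hj
      · by_contra hl
        simp only at hj hl
        obtain rfl : j = a := Fin.ext (by omega)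
        obtain rfl : l = b := Fin.ext (by omega)
        have h1 := congrArg (fun m => Mask.has m i) h0
        simp only [Mask.has_and, Mask.has_zero] at h1
        rw [mem_toSet] at hu hv
        simp [hu, hv] at h1
      · simp only at hj ⊢
        omega)
    rcases this with h1 | h1
    · obtain ⟨i, hi⟩ := (Mask.ne_zero_iff _).1 (hne a)
      exact absurd (show (i, a) ∈ (∅ : Set _) from h1 ▸ ⟨hi, le_rfl⟩) (by simp)
    · obtain ⟨i, hi⟩ := (Mask.ne_zero_iff _).1 (hne b)
      have hm : (i, b) ∈ toSet c := hi
      rw [← h1] at hm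
      have := hm.2
      simp only at this
      omega
  · intro hlink
    refine ⟨⟨⟨0, hn⟩, hne _⟩, fun S hS hcl => ?_⟩
    rcases S.eq_empty_or_nonempty with h0 | ⟨⟨i, j⟩, hij⟩
    · exact Or.inl h0
    refine Or.inr (hS.antisymm ?_)
    -- A closed set that touches a column swallows it; it then spreads through shared rows in both
    -- directions.
    have hcol : ∀ (j : Fin n), (∃ i, (i, j) ∈ S) → ∀ i, (i, j) ∈ toSet c → (i, j) ∈ S := by
      rintro j ⟨k, hk⟩ i hi
      by_cases hki : k = i
      · exact hki ▸ hk
      · exact hcl _ hk _ hi (by simp [SimpleGraph.boxProd_adj, hki])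
    have hstep : ∀ a b : Fin n, (a.val + 1 = b.val ∨ b.val + 1 = a.val) →
        (∃ i, (i, a) ∈ S) → ∃ i, (i, b) ∈ S := by
      intro a b hab ha
      obtain ⟨k, hk1, hk2⟩ : ∃ k, (c a).has k = true ∧ (c b).has k = true := by
        rcases hab with h | h
        · obtain ⟨k, hk⟩ := (Mask.ne_zero_iff _).1 (hlink a b h)
          rw [Mask.has_and] at hk
          exact ⟨k, by grind, by grind⟩
        · obtain ⟨k, hk⟩ := (Mask.ne_zero_iff _).1 (hlink b a h)
          rw [Mask.has_and] at hk
          exact ⟨k, by grind, by grind⟩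
      exact ⟨k, hcl _ (hcol a ha k hk1) _ hk2
        (by simpa [SimpleGraph.boxProd_adj, SimpleGraph.pathGraph_adj] using hab)⟩
    have hup : ∀ d : ℕ, ∀ l : Fin n, l.val = j.val + d → ∃ i, (i, l) ∈ S := by
      intro d
      induction d with
      | zero => intro l hl; obtain rfl : l = j := Fin.ext (by omega); exact ⟨i, hij⟩
      | succ d ih =>
        intro l hl
        exact hstep ⟨j.val + d, by omega⟩ l (Or.inl (by simp only; omega)) (ih _ rfl)
    have hdown : ∀ d : ℕ, ∀ l : Fin n, l.val + d = j.val → ∃ i, (i, l) ∈ S := by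
      intro d
      induction d with
      | zero => intro l hl; obtain rfl : l = j := Fin.ext (by omega); exact ⟨i, hij⟩
      | succ d ih =>
        intro l hl
        exact hstep ⟨l.val + 1, by omega⟩ l (Or.inr rfl) (ih _ (by simp only; omega))
    rintro ⟨k, l⟩ hkl
    refine hcol l ?_ k hkl
    rcases le_total j.val l.val with h | h
    · exact hup (l.val - j.val) l (by omega)
    · exact hdown (j.val - l.val) l (by omega)

/-! ### Disconnected words and the effect of appending a column. -/

/-- Some union of components of `c` is neither empty nor all of `c`. -/
def Bad {n : ℕ} (c : Fin n → Mask) : Prop := ∃ s, Cut c s ∧ s ≠ 0 ∧ s ≠ c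

theorem not_joined_iff_bad {n : ℕ} (hn : 0 < n) (c : Fin n → Mask) (hc : Chain c) :
    ¬ Joined c ↔ Bad c := by
  have : ∃ j, c j ≠ 0 := ⟨⟨0, hn⟩, hc.1 _⟩
  simp only [Joined, this, true_and, Bad]
  push Not
  refine exists_congr fun s => and_congr_right fun _ => and_congr_left fun _ => ?_
  exact Function.ne_iff.symm

theorem mem_badSets_toSet {n : ℕ} (hn : 0 < n) (c : Fin n → Mask) :
    toSet c ∈ badSets 4 n ↔ Chain c ∧ Bad c := by
  have h : toSet c ∈ badSets 4 n ↔ toSet c ∈ fullSets 4 n ∧ ¬ toSet c ∈ connSets (PP 4 n) := by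
    simp only [badSets, fullSets, Set.mem_ofPred_eq, Set.mem_sdiff]
    tauto
  rw [h, mem_fullSets_toSet hn, toSet_mem_connSets_PP]
  exact and_congr_right fun hc => not_joined_iff_bad hn c hc

variable {n : ℕ}

theorem forall_consecutive_snoc {P : Fin (n + 2) → Fin (n + 2) → Prop} :
    (∀ i j : Fin (n + 2), i.val + 1 = j.val → P i j) ↔
      (∀ i j : Fin (n + 1), i.val + 1 = j.val → P i.castSucc j.castSucc) ∧
        P (Fin.last n).castSucc (Fin.last (n + 1)) := by
  refine ⟨fun h => ⟨fun i j hij => h _ _ hij, h _ _ (by simp)⟩, fun ⟨h1, h2⟩ i j hij => ?_⟩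
  induction j using Fin.lastCases with
  | last =>
    obtain rfl : i = (Fin.last n).castSucc := Fin.ext (by simpa using hij)
    exact h2
  | cast j =>
    obtain ⟨k, rfl⟩ : ∃ k : Fin (n + 1), i = k.castSucc :=
      ⟨⟨i, by have := j.2; simp only [Fin.val_castSucc] at hij; omega⟩, rfl⟩
    exact h1 k j hij

theorem chain_snoc (c : Fin (n + 1) → Mask) (Y : Mask) :
    Chain (Fin.snoc c Y : Fin (n + 2) → Mask) ↔
      Chain c ∧ Y ≠ 0 ∧ c (Fin.last n) &&& Y ≠ 0 := by
  rw [Chain, Chain, forall_consecutive_snoc, Fin.forall_fin_succ']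
  simp only [Fin.snoc_castSucc, Fin.snoc_last]
  tauto

theorem cut_snoc (c s : Fin (n + 1) → Mask) (Y y : Mask) :
    Cut (Fin.snoc c Y : Fin (n + 2) → Mask) (Fin.snoc s y : Fin (n + 2) → Mask) ↔
      Cut c s ∧ LC Y y ∧ s (Fin.last n) &&& Y = y &&& c (Fin.last n) := by
  rw [Cut, Cut, forall_consecutive_snoc, Fin.forall_fin_succ']
  simp only [Fin.snoc_castSucc, Fin.snoc_last]
  tauto

theorem snoc_eq_zero (s : Fin n → Mask) (y : Mask) :
    (Fin.snoc s y : Fin (n + 1) → Mask) = 0 ↔ s = 0 ∧ y = 0 := by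
  simp only [funext_iff, Fin.forall_fin_succ', Fin.snoc_castSucc, Fin.snoc_last, Pi.zero_apply]

theorem snoc_eq_snoc (s c : Fin n → Mask) (y Y : Mask) :
    (Fin.snoc s y : Fin (n + 1) → Mask) = Fin.snoc c Y ↔ s = c ∧ y = Y := by
  simp only [funext_iff, Fin.forall_fin_succ', Fin.snoc_castSucc, Fin.snoc_last]

theorem exists_snoc {P : (Fin (n + 1) → Mask) → Prop} :
    (∃ s, P s) ↔ ∃ s y, P (Fin.snoc s y) :=
  ⟨fun ⟨s, hs⟩ => ⟨Fin.init s, s (Fin.last n), by rwa [Fin.snoc_init_self]⟩,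
    fun ⟨_, _, h⟩ => ⟨_, h⟩⟩

/-- Some component of `c` does not reach the last column. -/
def Dead (c : Fin (n + 1) → Mask) : Prop := ∃ s, Cut c s ∧ s ≠ 0 ∧ s (Fin.last n) = 0

/-- The traces on the last column of the unions of components of `c`. -/
def Trace (c : Fin (n + 1) → Mask) (x : Mask) : Prop := ∃ s, Cut c s ∧ s (Fin.last n) = x

theorem lc_compl : ∀ X y : Mask, LC X y → LC X (X ^^^ y) := by decide +kernel

theorem lc_zero : ∀ X : Mask, LC X 0 := by decide +kernel

theorem lc_self : ∀ X : Mask, LC X X := by decide +kernel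

theorem and_xor_link : ∀ X Y x : Mask, LC X x →
    ∀ y, LC Y y → x &&& Y = y &&& X → (X ^^^ x) &&& Y = (Y ^^^ y) &&& X := by decide +kernel

theorem xor_eq_zero_iff : ∀ X x : Mask, X ^^^ x = 0 ↔ x = X := by decide +kernel

theorem Mask.and_comm' : ∀ X Y : Mask, X &&& Y = Y &&& X := by decide +kernel

theorem Mask.zero_and' : ∀ X : Mask, 0 &&& X = 0 := by decide +kernel

theorem Cut.compl {c s : Fin n → Mask} (h : Cut c s) : Cut c (fun j => c j ^^^ s j) :=
  ⟨fun j => lc_compl _ _ (h.1 j), fun i j hij =>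
    and_xor_link _ _ _ (h.1 i) _ (h.1 j) (h.2 i j hij)⟩

theorem cut_zero (c : Fin n → Mask) : Cut c 0 :=
  ⟨fun _ => lc_zero _, fun _ _ _ => by simp [Mask.zero_and']⟩

theorem cut_self (c : Fin n → Mask) : Cut c c :=
  ⟨fun _ => lc_self _, fun _ _ _ => Mask.and_comm' _ _⟩

theorem Trace.lc {c : Fin (n + 1) → Mask} {x : Mask} (h : Trace c x) : LC (c (Fin.last n)) x := by
  obtain ⟨s, hs, rfl⟩ := h
  exact hs.1 _

/-- `x` is cut off by the next column `Y`. -/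
def Kills (Y x : Mask) : Prop := x ≠ 0 ∧ x &&& Y = 0

/-- The union of components with trace `x` stays proper after adding the column `Y`. -/
def Spoils (X Y x : Mask) : Prop :=
  Kills Y x ∨ ∃ y, y ≠ 0 ∧ y ≠ Y ∧ LC Y y ∧ x &&& Y = y &&& X

instance (Y x : Mask) : Decidable (Kills Y x) := by unfold Kills; infer_instance
instance (X Y x : Mask) : Decidable (Spoils X Y x) := by unfold Spoils; infer_instance

/-- If a proper union of components contains the whole last column, its complement is nonempty and
misses that column, so this case is dead as well. -/
theorem bad_iff (c : Fin (n + 1) → Mask) (hc : c (Fin.last n) ≠ 0) :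
    Bad c ↔ Dead c ∨ ∃ x, Trace c x ∧ x ≠ 0 ∧ x ≠ c (Fin.last n) := by
  constructor
  · rintro ⟨s, hs, h0, h1⟩
    by_cases h2 : s (Fin.last n) = 0
    · exact Or.inl ⟨s, hs, h0, h2⟩
    by_cases h3 : s (Fin.last n) = c (Fin.last n)
    · refine Or.inl ⟨_, hs.compl, fun h => h1 ?_, (xor_eq_zero_iff _ _).2 h3⟩
      funext j
      exact (xor_eq_zero_iff _ _).1 (congrFun h j)
    · exact Or.inr ⟨_, ⟨s, hs, rfl⟩, h2, h3⟩
  · rintro (⟨s, hs, h0, h1⟩ | ⟨x, ⟨s, hs, rfl⟩, h0, h1⟩)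
    · exact ⟨s, hs, h0, fun h => hc (h ▸ h1)⟩
    · exact ⟨s, hs, fun h => h0 (by simp [h]), fun h => h1 (by simp [h])⟩

/-- A union of components missing `Y` either missed the previous column already, or its trace there
shares no row with `Y`. -/
theorem dead_snoc (c : Fin (n + 1) → Mask) (Y : Mask) :
    Dead (Fin.snoc c Y : Fin (n + 2) → Mask) ↔ Dead c ∨ ∃ x, Trace c x ∧ Kills Y x := by
  rw [Dead, exists_snoc]
  simp only [cut_snoc, ne_eq, snoc_eq_zero, Fin.snoc_last]
  constructor
  · rintro ⟨s, y, ⟨hs, -, hl⟩, h0, rfl⟩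
    rw [Mask.zero_and'] at hl
    by_cases h : s (Fin.last n) = 0
    · exact Or.inl ⟨s, hs, by simpa using h0, h⟩
    · exact Or.inr ⟨_, ⟨s, hs, rfl⟩, h, hl⟩
  · rintro (⟨s, hs, h0, h1⟩ | ⟨_, ⟨s, hs, rfl⟩, h0, h1⟩)
    · exact ⟨s, 0, ⟨hs, lc_zero _, by rw [h1, Mask.zero_and', Mask.zero_and']⟩, by simp [h0], rfl⟩
    · exact ⟨s, 0, ⟨hs, lc_zero _, by rw [h1, Mask.zero_and']⟩,
        fun h => h0 (by simp [h.1]), rfl⟩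

theorem trace_snoc (c : Fin (n + 1) → Mask) (Y y : Mask) :
    Trace (Fin.snoc c Y : Fin (n + 2) → Mask) y ↔
      LC Y y ∧ ∃ x, Trace c x ∧ x &&& Y = y &&& c (Fin.last n) := by
  rw [Trace, exists_snoc]
  simp only [cut_snoc, Fin.snoc_last]
  constructor
  · rintro ⟨s, y, ⟨hs, h, hl⟩, rfl⟩
    exact ⟨h, _, ⟨s, hs, rfl⟩, hl⟩
  · rintro ⟨h, _, ⟨s, hs, rfl⟩, hl⟩
    exact ⟨s, y, ⟨hs, h, hl⟩, rfl⟩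

theorem bad_snoc_iff_spoils (c : Fin (n + 1) → Mask) (Y : Mask) (hY : Y ≠ 0) :
    Bad (Fin.snoc c Y : Fin (n + 2) → Mask) ↔
      Dead c ∨ ∃ x, Trace c x ∧ Spoils (c (Fin.last n)) Y x := by
  rw [bad_iff _ (by simpa using hY), dead_snoc, Fin.snoc_last]
  simp only [trace_snoc, Spoils]
  constructor
  · rintro ((h | ⟨x, hx, h⟩) | ⟨y, ⟨hy, x, hx, h⟩, h0, h1⟩)
    · exact Or.inl h
    · exact Or.inr ⟨x, hx, Or.inl h⟩
    · exact Or.inr ⟨x, hx, Or.inr ⟨y, h0, h1, hy, h⟩⟩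
  · rintro (h | ⟨x, hx, h | ⟨y, h0, h1, hy, h⟩⟩)
    · exact Or.inl (Or.inl h)
    · exact Or.inl (Or.inr ⟨x, hx, h⟩)
    · exact Or.inr ⟨y, ⟨hy, x, hx, h⟩, h0, h1⟩

/-- This and `step_from_split` are the induction steps of `trace_dichotomy`. They rest on there
being only four rows: `Y` has at most two runs, which are joined or not, with no partial merging in
between. -/
theorem step_from_joined : ∀ X Y : Mask, X &&& Y ≠ 0 →
    (∀ y, (LC Y y ∧ ∃ x, (x = 0 ∨ x = X) ∧ x &&& Y = y &&& X) ↔ y = 0 ∨ y = Y) ∨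
    (∀ y, (LC Y y ∧ ∃ x, (x = 0 ∨ x = X) ∧ x &&& Y = y &&& X) ↔ LC Y y) := by
  decide +kernel

theorem step_from_split : ∀ X Y : Mask, X &&& Y ≠ 0 → (¬ ∃ x, LC X x ∧ Kills Y x) →
    (∀ y, (LC Y y ∧ ∃ x, LC X x ∧ x &&& Y = y &&& X) ↔ y = 0 ∨ y = Y) ∨
    (∀ y, (LC Y y ∧ ∃ x, LC X x ∧ x &&& Y = y &&& X) ↔ LC Y y) := by
  decide +kernel

theorem trace_one (c : Fin 1 → Mask) (x : Mask) : Trace c x ↔ LC (c 0) x := by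
  constructor
  · exact Trace.lc
  · intro h
    refine ⟨fun _ => x, ⟨fun j => ?_, fun i j hij => by omega⟩, rfl⟩
    rwa [Subsingleton.elim (α := Fin 1) j 0]

theorem not_dead_one (c : Fin 1 → Mask) : ¬ Dead c := by
  rintro ⟨s, -, h, h0⟩
  refine h (funext fun j => ?_)
  rw [Subsingleton.elim (α := Fin 1) j (Fin.last 0), h0]
  rfl

/-- The last column of a word without dead components is connected, or no two of its runs are. -/
theorem trace_dichotomy (c : Fin (n + 1) → Mask) (hc : Chain c) (hd : ¬ Dead c) :
    (∀ x, Trace c x ↔ x = 0 ∨ x = c (Fin.last n)) ∨ (∀ x, Trace c x ↔ LC (c (Fin.last n)) x) := by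
  induction n with
  | zero => exact Or.inr (trace_one c)
  | succ n ih =>
    obtain ⟨c, Y, rfl⟩ : ∃ c' Y, c = Fin.snoc c' Y :=
      ⟨Fin.init c, c (Fin.last _), (Fin.snoc_init_self c).symm⟩
    rw [chain_snoc] at hc
    rw [dead_snoc, not_or] at hd
    simp only [trace_snoc, Fin.snoc_last]
    rcases ih c hc.1 hd.1 with h | h
    · simp only [h]
      exact step_from_joined _ _ hc.2.2
    · simp only [h] at hd ⊢
      exact step_from_split _ _ hc.2.2 hd.2

/-! ### Transitions between joined, split and dead words. -/

/-- Adding `Y` disconnects a connected word ending in `X`. -/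
def SpoilsJoined (X Y : Mask) : Prop := Spoils X Y 0 ∨ Spoils X Y X

/-- Adding `Y` does not connect a word ending in `X` with separated runs. -/
def SpoilsSplit (X Y : Mask) : Prop := ∃ x, LC X x ∧ Spoils X Y x

/-- Adding `Y` cuts off some run of `X`. -/
def KillsSplit (X Y : Mask) : Prop := ∃ x, LC X x ∧ Kills Y x

/-- `X` has a single run. -/
def SingleRun (X : Mask) : Prop := ∀ x, LC X x → x = 0 ∨ x = X

instance (X Y : Mask) : Decidable (SpoilsJoined X Y) := by unfold SpoilsJoined; infer_instance
instance (X Y : Mask) : Decidable (SpoilsSplit X Y) := by unfold SpoilsSplit; infer_instance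
instance (X Y : Mask) : Decidable (KillsSplit X Y) := by unfold KillsSplit; infer_instance
instance (X : Mask) : Decidable (SingleRun X) := by unfold SingleRun; infer_instance

theorem Dead.bad {c : Fin (n + 1) → Mask} (hc : Chain c) (h : Dead c) : Bad c :=
  (bad_iff c (hc.1 _)).2 (Or.inl h)

/-- A single run has no proper nonempty trace. -/
theorem bad_iff_dead_of_singleRun (c : Fin (n + 1) → Mask) (hc : Chain c)
    (h : SingleRun (c (Fin.last n))) : Bad c ↔ Dead c := by
  refine ⟨fun hb => ?_, Dead.bad hc⟩
  rcases (bad_iff c (hc.1 _)).1 hb with hb | ⟨x, hx, h0, h1⟩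
  · exact hb
  · exact ((h x hx.lc).elim h0 h1).elim

theorem trace_of_not_bad {c : Fin (n + 1) → Mask} (hc : Chain c) (h : ¬ Bad c) (x : Mask) :
    Trace c x ↔ x = 0 ∨ x = c (Fin.last n) := by
  rw [bad_iff c (hc.1 _)] at h
  push Not at h
  refine ⟨fun hx => or_iff_not_imp_left.2 fun h0 => h.2 x hx h0, ?_⟩
  rintro (rfl | rfl)
  · exact ⟨0, cut_zero c, rfl⟩
  · exact ⟨c, cut_self c, rfl⟩

theorem trace_of_bad {c : Fin (n + 1) → Mask} (hc : Chain c) (h : Bad c) (hd : ¬ Dead c)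
    (x : Mask) : Trace c x ↔ LC (c (Fin.last n)) x := by
  rcases trace_dichotomy c hc hd with h1 | h1
  · rcases (bad_iff c (hc.1 _)).1 h with hb | ⟨y, hy, h0, h2⟩
    · exact absurd hb hd
    · exact (((h1 y).1 hy).elim h0 h2).elim
  · exact h1 x

theorem not_kills_self {X Y : Mask} (h : X &&& Y ≠ 0) (x : Mask) (hx : x = 0 ∨ x = X) :
    ¬ Kills Y x := by
  rintro ⟨h0, h1⟩
  rcases hx with rfl | rfl
  · exact h0 rfl
  · exact h h1

theorem spoilsSplit_of_spoilsJoined {X Y : Mask} (h : SpoilsJoined X Y) : SpoilsSplit X Y :=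
  h.elim (fun h => ⟨0, lc_zero _, h⟩) (fun h => ⟨X, lc_self _, h⟩)

/-- The three disjuncts correspond to the states of the prefix. Whatever spoils a joined word also
spoils a split one, and a dead word stays bad, so the conditions are nested and no case split on the
state is left in the statement. -/
theorem bad_snoc (c : Fin (n + 1) → Mask) (X Y : Mask) (hc : Chain c) (hX : c (Fin.last n) = X)
    (hY : Y ≠ 0) :
    Bad (Fin.snoc c Y : Fin (n + 2) → Mask) ↔
      SpoilsJoined X Y ∨ (SpoilsSplit X Y ∧ Bad c) ∨ Dead c := by
  rw [bad_snoc_iff_spoils c Y hY]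
  subst hX
  by_cases hd : Dead c
  · simp [hd]
  by_cases hb : Bad c
  · simp only [trace_of_bad hc hb hd, hd, hb, false_or, or_false, and_true]
    exact ⟨Or.inr, fun h => h.elim spoilsSplit_of_spoilsJoined id⟩
  · simp only [trace_of_not_bad hc hb, hd, hb, false_or, or_false, and_false, SpoilsJoined,
      or_and_right, exists_or, exists_eq_left]

/-- A joined prefix cannot die here, since its only component continues through a row shared by `X`
and `Y`. -/
theorem dead_snoc' (c : Fin (n + 1) → Mask) (X Y : Mask) (hc : Chain c)
    (hX : c (Fin.last n) = X) (hXY : X &&& Y ≠ 0) :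
    Dead (Fin.snoc c Y : Fin (n + 2) → Mask) ↔ (KillsSplit X Y ∧ Bad c) ∨ Dead c := by
  rw [dead_snoc]
  subst hX
  by_cases hd : Dead c
  · simp [hd]
  by_cases hb : Bad c
  · simp only [trace_of_bad hc hb hd, hd, hb, false_or, or_false, and_true]
    rfl
  · simp only [trace_of_not_bad hc hb, hd, hb, false_or, or_false, and_false, iff_false]
    rintro ⟨x, hx, h⟩
    exact not_kills_self hXY x hx h

/-! ### Counting words by their last column. -/

open scoped Classical in
/-- The number of chains of `n + 1` columns with last column `X` and the property `P`. -/
noncomputable def cnt (n : ℕ) (X : Mask) (P : (Fin (n + 1) → Mask) → Prop) : ℕ :=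
  (Finset.univ.filter fun c : Fin (n + 1) → Mask => Chain c ∧ c (Fin.last n) = X ∧ P c).card

theorem cnt_congr {X : Mask} {P Q : (Fin (n + 1) → Mask) → Prop}
    (h : ∀ c, Chain c → c (Fin.last n) = X → (P c ↔ Q c)) : cnt n X P = cnt n X Q := by
  unfold cnt
  congr 1
  ext c
  simp only [Finset.mem_filter, Finset.mem_univ, true_and]
  exact and_congr_right fun hc => and_congr_right fun hX => h c hc hX

theorem cnt_false (X : Mask) : cnt n X (fun _ => False) = 0 := by
  simp [cnt]

theorem cnt_succ (Y : Mask) (P : (Fin (n + 2) → Mask) → Prop) :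
    cnt (n + 1) Y P =
      ∑ X : Mask, if X &&& Y ≠ 0 then cnt n X (fun c => P (Fin.snoc c Y)) else 0 := by
  classical
  have h : cnt (n + 1) Y P = (Finset.univ.filter fun c : Fin (n + 1) → Mask =>
      Chain c ∧ c (Fin.last n) &&& Y ≠ 0 ∧ P (Fin.snoc c Y)).card := by
    unfold cnt
    symm
    refine Finset.card_bij (fun c _ => Fin.snoc c Y) ?_ ?_ ?_
    · intro c hc
      simp only [Finset.mem_filter, Finset.mem_univ, true_and] at hc ⊢
      refine ⟨(chain_snoc c Y).2 ⟨hc.1, fun h0 => hc.2.1 ?_, hc.2.1⟩, Fin.snoc_last .., hc.2.2⟩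
      rw [h0, Mask.and_comm', Mask.zero_and']
    · intro c _ d _ hcd
      exact ((snoc_eq_snoc c d Y Y).1 hcd).1
    · intro c hc
      simp only [Finset.mem_filter, Finset.mem_univ, true_and] at hc
      have hs : (Fin.snoc (Fin.init c) Y : Fin (n + 2) → Mask) = c := by
        rw [← hc.2.1, Fin.snoc_init_self]
      refine ⟨Fin.init c, ?_, hs⟩
      simp only [Finset.mem_filter, Finset.mem_univ, true_and, hs]
      have := hc.1
      rw [← hs, chain_snoc] at this
      exact ⟨this.1, this.2.2, hc.2.2⟩
  rw [h, Finset.card_eq_sum_card_fiberwise (f := fun c => c (Fin.last n)) (t := Finset.univ)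
    (fun _ _ => Finset.mem_coe.2 (Finset.mem_univ _))]
  refine Finset.sum_congr rfl fun X _ => ?_
  rw [Finset.filter_filter]
  split_ifs with hX
  · unfold cnt
    congr 1
    ext c
    simp only [Finset.mem_filter, Finset.mem_univ, true_and]
    constructor
    · rintro ⟨⟨h1, -, h3⟩, h4⟩; exact ⟨h1, h4, h3⟩
    · rintro ⟨h1, rfl, h3⟩; exact ⟨⟨h1, hX, h3⟩, rfl⟩
  · rw [Finset.card_eq_zero, Finset.filter_eq_empty_iff]
    rintro c - ⟨⟨-, h2, -⟩, rfl⟩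
    exact hX h2

theorem cnt_zero (X : Mask) (P : (Fin 1 → Mask) → Prop) [Decidable (X ≠ 0 ∧ P fun _ => X)] :
    cnt 0 X P = if X ≠ 0 ∧ P (fun _ => X) then 1 else 0 := by
  classical
  unfold cnt
  have h : ∀ c : Fin 1 → Mask, (Chain c ∧ c (Fin.last 0) = X ∧ P c) ↔
      c = (fun _ => X) ∧ (X ≠ 0 ∧ P fun _ => X) := by
    intro c
    constructor
    · rintro ⟨h1, rfl, h3⟩
      have : c = fun _ => c (Fin.last 0) :=
        funext fun j => by rw [Subsingleton.elim (α := Fin 1) j (Fin.last 0)]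
      exact ⟨this, h1.1 _, this ▸ h3⟩
    · rintro ⟨rfl, h2, h3⟩
      exact ⟨⟨fun _ => h2, fun i j hij => by omega⟩, rfl, h3⟩
  simp only [h]
  split_ifs with hX
  · simp [hX, Finset.filter_eq']
  · rw [Finset.card_eq_zero, Finset.filter_eq_empty_iff]
    exact fun c _ hc => hX hc.2

/-- The number of chains of `n + 1` columns ending in `X`. -/
noncomputable def cntAll (n : ℕ) (X : Mask) : ℕ := cnt n X fun _ => True

/-- The number of disconnected chains of `n + 1` columns ending in `X`. -/
noncomputable def cntBad (n : ℕ) (X : Mask) : ℕ := cnt n X Bad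

/-- The number of chains ending in `X` with a component that misses the last column. -/
noncomputable def cntDead (n : ℕ) (X : Mask) : ℕ := cnt n X Dead

theorem cntAll_zero (X : Mask) : cntAll 0 X = if X ≠ 0 then 1 else 0 := by
  rw [cntAll, cnt_zero]
  simp

theorem cntDead_zero (X : Mask) : cntDead 0 X = 0 := by
  rw [cntDead, cnt_congr (Q := fun _ => False) (fun c _ _ => iff_false_intro (not_dead_one c)),
    cnt_false]

theorem cntBad_zero (X : Mask) : cntBad 0 X = if X ≠ 0 ∧ ¬ SingleRun X then 1 else 0 := by
  classical
  rw [cntBad, cnt_zero]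
  congr 1
  refine propext (and_congr_right fun hX => ?_)
  rw [bad_iff _ hX]
  simp only [not_dead_one, trace_one, false_or, SingleRun]
  push Not
  rfl

theorem cntAll_succ (Y : Mask) :
    cntAll (n + 1) Y = ∑ X : Mask, if X &&& Y ≠ 0 then cntAll n X else 0 := cnt_succ Y _

/-- If `Y` spoils even joined words, all words count; if only split ones, the bad words; if neither,
the dead ones. Single-run `X` is moved to the bad counts, where bad equals dead, so that dead counts
occur only for two-run columns. -/
theorem cntBad_succ (Y : Mask) :
    cntBad (n + 1) Y = ∑ X : Mask, if X &&& Y ≠ 0 then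
      (if SpoilsJoined X Y then cntAll n X else if SpoilsSplit X Y ∨ SingleRun X then cntBad n X
        else cntDead n X) else 0 := by
  rw [cntBad, cnt_succ]
  refine Finset.sum_congr rfl fun X _ => ?_
  split_ifs with h1 h2 h3
  · refine cnt_congr fun c hc hX => ?_
    rw [bad_snoc c X Y hc hX (by rintro rfl; exact h1 (by rw [Mask.and_comm', Mask.zero_and']))]
    simp [h2]
  · refine cnt_congr fun c hc hX => ?_
    rw [bad_snoc c X Y hc hX (by rintro rfl; exact h1 (by rw [Mask.and_comm', Mask.zero_and']))]
    rcases h3 with h3 | h3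
    · have := Dead.bad hc
      simp only [h2, h3]
      tauto
    · rw [← bad_iff_dead_of_singleRun c hc (hX ▸ h3)]
      tauto
  · refine cnt_congr fun c hc hX => ?_
    rw [bad_snoc c X Y hc hX (by rintro rfl; exact h1 (by rw [Mask.and_comm', Mask.zero_and']))]
    tauto
  · rfl

theorem cntDead_succ (Y : Mask) :
    cntDead (n + 1) Y = ∑ X : Mask, if X &&& Y ≠ 0 then
      (if KillsSplit X Y ∨ SingleRun X then cntBad n X else cntDead n X) else 0 := by
  rw [cntDead, cnt_succ]
  refine Finset.sum_congr rfl fun X _ => ?_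
  split_ifs with h1 h2
  · refine cnt_congr fun c hc hX => ?_
    rw [dead_snoc' c X Y hc hX h1]
    rcases h2 with h2 | h2
    · have := Dead.bad hc
      tauto
    · rw [← bad_iff_dead_of_singleRun c hc (hX ▸ h2)]
      tauto
  · refine cnt_congr fun c hc hX => ?_
    rw [dead_snoc' c X Y hc hX h1]
    tauto
  · rfl

/-- Explicit lists turn each recurrence into a finite check of which `X` falls under which case. -/
theorem cntBad_succ_eq_sums (Y : Mask) (A B D : List Mask)
    (hA : A.Nodup ∧ Finset.univ.filter (fun X => X &&& Y ≠ 0 ∧ SpoilsJoined X Y) = A.toFinset)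
    (hB : B.Nodup ∧ Finset.univ.filter (fun X => X &&& Y ≠ 0 ∧ ¬ SpoilsJoined X Y ∧
      (SpoilsSplit X Y ∨ SingleRun X)) = B.toFinset)
    (hD : D.Nodup ∧ Finset.univ.filter (fun X => X &&& Y ≠ 0 ∧ ¬ SpoilsJoined X Y ∧
      ¬ (SpoilsSplit X Y ∨ SingleRun X)) = D.toFinset) :
    cntBad (n + 1) Y =
      (A.map (cntAll n)).sum + (B.map (cntBad n)).sum + (D.map (cntDead n)).sum := by
  rw [cntBad_succ, ← List.sum_toFinset _ hA.1, ← List.sum_toFinset _ hB.1,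
    ← List.sum_toFinset _ hD.1, ← hA.2, ← hB.2, ← hD.2, Finset.sum_filter, Finset.sum_filter,
    Finset.sum_filter, ← Finset.sum_add_distrib, ← Finset.sum_add_distrib]
  refine Finset.sum_congr rfl fun X _ => ?_
  split_ifs <;> first | tauto | simp

theorem cntDead_succ_eq_sums (Y : Mask) (B D : List Mask)
    (hB : B.Nodup ∧ Finset.univ.filter (fun X => X &&& Y ≠ 0 ∧
      (KillsSplit X Y ∨ SingleRun X)) = B.toFinset)
    (hD : D.Nodup ∧ Finset.univ.filter (fun X => X &&& Y ≠ 0 ∧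
      ¬ (KillsSplit X Y ∨ SingleRun X)) = D.toFinset) :
    cntDead (n + 1) Y = (B.map (cntBad n)).sum + (D.map (cntDead n)).sum := by
  rw [cntDead_succ, ← List.sum_toFinset _ hB.1, ← List.sum_toFinset _ hD.1, ← hB.2, ← hD.2,
    Finset.sum_filter, Finset.sum_filter, ← Finset.sum_add_distrib]
  refine Finset.sum_congr rfl fun X _ => ?_
  split_ifs <;> first | tauto | simp

/-! ### Reflection symmetry. -/

/-- Turning a column upside down. -/
def Mask.flip (X : Mask) : Mask :=
  ⟨(X.val % 2) * 8 + (X.val / 2 % 2) * 4 + (X.val / 4 % 2) * 2 + X.val / 8, by omega⟩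

theorem Mask.flip_involutive : Function.Involutive Mask.flip := by
  unfold Function.Involutive
  decide +kernel

theorem flip_and_ne_zero : ∀ X Y : Mask, X.flip &&& Y.flip ≠ 0 ↔ X &&& Y ≠ 0 := by decide +kernel

theorem spoilsJoined_flip : ∀ X Y : Mask, SpoilsJoined X.flip Y.flip ↔ SpoilsJoined X Y := by
  decide +kernel

theorem spoilsSplit_flip : ∀ X Y : Mask, SpoilsSplit X.flip Y.flip ↔ SpoilsSplit X Y := by
  decide +kernel

theorem killsSplit_flip : ∀ X Y : Mask, KillsSplit X.flip Y.flip ↔ KillsSplit X Y := by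
  decide +kernel

theorem singleRun_flip : ∀ X : Mask, SingleRun X.flip ↔ SingleRun X := by decide +kernel

theorem flip_ne_zero : ∀ X : Mask, X.flip ≠ 0 ↔ X ≠ 0 := by decide +kernel

theorem cnt_flip (n : ℕ) : ∀ X : Mask, cntAll n X.flip = cntAll n X ∧
    cntBad n X.flip = cntBad n X ∧ cntDead n X.flip = cntDead n X := by
  induction n with
  | zero =>
    intro X
    simp only [cntAll_zero, cntBad_zero, cntDead_zero, flip_ne_zero, singleRun_flip, and_self]
  | succ n ih =>
    intro Y
    have e := fun φ : Mask → ℕ => (Equiv.sum_comp Mask.flip_involutive.toPerm φ).symm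
    refine ⟨?_, ?_, ?_⟩
    · rw [cntAll_succ, cntAll_succ, e]
      simp only [Function.Involutive.coe_toPerm, flip_and_ne_zero, ih]
    · rw [cntBad_succ, cntBad_succ, e]
      simp only [Function.Involutive.coe_toPerm, flip_and_ne_zero, ih, spoilsJoined_flip,
        spoilsSplit_flip, singleRun_flip]
    · rw [cntDead_succ, cntDead_succ, e]
      simp only [Function.Involutive.coe_toPerm, flip_and_ne_zero, ih, killsSplit_flip,
        singleRun_flip]

/-! ### The transfer matrix. -/

/-- One less than the number of rows in a nonempty column. -/
def Mask.level (X : Mask) : Fin 4 :=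
  Fin.ofNat 4 (X.val % 2 + X.val / 2 % 2 + X.val / 4 % 2 + X.val / 8 - 1)

/-- Among the columns with `q` rows, those missing `Y` number `choose (4 - |Y|) q`; hence the entry
is `choose 4 q - choose (4 - |Y|) q`, where `q = p + 1`. -/
theorem card_linked : ∀ (Y : Mask) (p : Fin 4), Y ≠ 0 →
    (Finset.univ.filter fun X : Mask => X &&& Y ≠ 0 ∧ X.level = p).card =
      transfer Y.level p := by decide +kernel

theorem f_succ (k : ℕ) (p : Fin 4) : f (k + 2) p = ∑ q, transfer p q * f (k + 1) q := by
  simp only [f, Nat.add_sub_cancel, show k + 2 - 1 = k + 1 by omega, pow_succ' transfer k,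
    ← Matrix.mulVec_mulVec]
  rfl

theorem cntAll_eq (n : ℕ) : ∀ X : Mask, X ≠ 0 → cntAll n X = f (n + 1) X.level := by
  induction n with
  | zero => intro X hX; simp [cntAll_zero, hX, f]
  | succ n ih =>
    intro Y hY
    rw [cntAll_succ, f_succ, ← Finset.sum_filter,
      ← Finset.sum_fiberwise_of_maps_to (g := Mask.level) (t := Finset.univ)
        (fun _ _ => Finset.mem_univ _)]
    refine Finset.sum_congr rfl fun p _ => ?_
    rw [← card_linked Y p hY, ← smul_eq_mul, ← Finset.sum_const, Finset.filter_filter]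
    refine Finset.sum_congr rfl fun X hX => ?_
    simp only [Finset.mem_filter, Finset.mem_univ, true_and] at hX
    rw [ih X (by rintro rfl; exact hX.1 (Mask.zero_and' _)), hX.2]

theorem sum_mask (φ : Mask → ℕ) : ∑ X, φ X = φ 0 + φ 1 + φ 2 + φ 3 + φ 4 + φ 5 + φ 6 + φ 7 + φ 8 +
    φ 9 + φ 10 + φ 11 + φ 12 + φ 13 + φ 14 + φ 15 := by
  simp only [Fin.sum_univ_castSucc, Fin.sum_univ_zero, zero_add]
  rfl

theorem cnt_empty (P : (Fin (n + 1) → Mask) → Prop) : cnt n 0 P = 0 := by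
  classical
  unfold cnt
  rw [Finset.card_eq_zero, Finset.filter_eq_empty_iff]
  rintro c - ⟨h1, h2, -⟩
  exact h1.1 _ h2

theorem cntAll_sum (n : ℕ) : ∑ X, cntAll n X = N4 (n + 1) := by
  have h : ∀ p, f (n + 1) p = ((transfer ^ n) *ᵥ fun _ => 1) p := fun _ => rfl
  rw [sum_mask, show cntAll n 0 = 0 from cnt_empty _]
  repeat rw [cntAll_eq _ _ (by decide)]
  rw [show N4 (n + 1) = ∑ p, (![4, 6, 4, 1] : Fin 4 → ℕ) p * f (n + 1) p from rfl]
  simp only [Fin.sum_univ_four]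
  rw [show Mask.level 1 = 0 by decide, show Mask.level 2 = 0 by decide,
    show Mask.level 3 = 1 by decide, show Mask.level 4 = 0 by decide,
    show Mask.level 5 = 1 by decide, show Mask.level 6 = 1 by decide,
    show Mask.level 7 = 2 by decide, show Mask.level 8 = 0 by decide,
    show Mask.level 9 = 1 by decide, show Mask.level 10 = 1 by decide,
    show Mask.level 11 = 2 by decide, show Mask.level 12 = 1 by decide,
    show Mask.level 13 = 2 by decide, show Mask.level 14 = 2 by decide,
    show Mask.level 15 = 3 by decide]
  simp
  ring

theorem cntBad_sum (n : ℕ) : ∑ X, cntBad n X = 2 * cntBad n 1 + 2 * cntBad n 2 + 2 * cntBad n 3 +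
    cntBad n 6 + 2 * cntBad n 5 + cntBad n 9 + 2 * cntBad n 7 + 2 * cntBad n 11 + cntBad n 15 := by
  have h := fun X => (cnt_flip n X).2.1
  rw [sum_mask, show cntBad n 0 = 0 from cnt_empty _, show cntBad n 8 = cntBad n 1 from h 1,
    show cntBad n 4 = cntBad n 2 from h 2, show cntBad n 12 = cntBad n 3 from h 3,
    show cntBad n 10 = cntBad n 5 from h 5, show cntBad n 14 = cntBad n 7 from h 7,
    show cntBad n 13 = cntBad n 11 from h 11]
  ring

/-- When `Y` joins all the runs of `X` and leaves nothing of its own apart, the longer word is bad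
only if a component had died before `X`. Prescribing the last two columns thus isolates the dead
words ending in `X`. -/
theorem cnt_bad_last_two {X Y : Mask} (hXY : X &&& Y ≠ 0) (h : ¬ SpoilsSplit X Y) :
    cnt (n + 1) Y (fun c => Bad c ∧ c (Fin.last n).castSucc = X) = cntDead n X := by
  rw [cnt_succ, Finset.sum_eq_single X]
  · rw [if_pos hXY]
    refine cnt_congr fun c hc hX => ?_
    rw [bad_snoc c X Y hc hX (by rintro rfl; exact hXY (by rw [Mask.and_comm', Mask.zero_and'])),
      Fin.snoc_castSucc]
    have := mt spoilsSplit_of_spoilsJoined h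
    tauto
  · intro Z _ hZ
    split_ifs
    · rw [cnt_congr (Q := fun _ => False), cnt_false]
      rintro c - rfl
      simp [hZ]
    · rfl
  · exact fun h => absurd (Finset.mem_univ _) h

/-! ### From counts of vertex sets to counts of words. -/

theorem ncard_eq_card_words (P : Set (Fin 4 × Fin n) → Prop)
    (Q : (Fin n → Mask) → Prop) {_ : DecidablePred Q} (h : ∀ c, P (toSet c) ↔ Q c) :
    {C | P C}.ncard = (Finset.univ.filter Q).card := by
  have : {C | P C} = toSet '' {c | Q c} := by
    ext C
    obtain ⟨c, rfl⟩ := (toSet_bijective n).2 C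
    rw [(toSet_bijective n).1.mem_set_image]
    exact h c
  rw [this, Set.ncard_image_of_injective _ (toSet_bijective n).1, ← Set.ncard_coe_finset]
  simp

theorem agreesWith_toSet (c d : Fin n → Mask) :
    AgreesWith (toSet c) (toSet d) ↔ ∀ j, d j ≠ 0 → c j = d j := by
  have hne : ∀ j : Fin n, (toSet d ∩ column 4 n (j + 1)).Nonempty ↔ d j ≠ 0 := by
    intro j
    rw [Mask.ne_zero_iff]
    constructor
    · rintro ⟨⟨i, k⟩, h1, h2⟩
      obtain rfl : k = j := Fin.ext (by have : (k : ℕ) + 1 = j + 1 := h2; omega)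
      exact ⟨i, h1⟩
    · rintro ⟨i, hi⟩
      exact ⟨(i, j), hi, rfl⟩
  have heq : ∀ j : Fin n, toSet c ∩ column 4 n (j + 1) = toSet d ∩ column 4 n (j + 1) ↔
      c j = d j := by
    intro j
    constructor
    · intro h
      refine Mask.ext_has fun i => Bool.eq_iff_iff.2 ?_
      have : (i, j) ∈ toSet c ∩ column 4 n (j + 1) ↔ (i, j) ∈ toSet d ∩ column 4 n (j + 1) := by
        rw [h]
      simpa [column, mem_toSet] using this
    · intro h
      ext ⟨i, k⟩
      refine and_congr_left fun hk => ?_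
      obtain rfl : k = j := Fin.ext (by have : (k : ℕ) + 1 = j + 1 := hk; omega)
      rw [mem_toSet, mem_toSet, h]
  simp only [← hne, ← heq]
  constructor
  · exact fun h j => h (j + 1) (by simp)
  · intro h j hj
    rw [Finset.mem_Icc] at hj
    have := h ⟨j - 1, by omega⟩
    rwa [show ((⟨j - 1, by omega⟩ : Fin n) : ℕ) + 1 = j by simp only; omega] at this

/-- `AgreesWith` leaves free every column that the prescribed set misses, so `X` has to be nonempty
for the last column to be fixed. -/
theorem agreesWith_last (c : Fin (n + 1) → Mask) (X : Mask) (S : Set ℕ) (hX : X ≠ 0)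
    (hS : ∀ i : Fin 4, X.has i = true ↔ i.val + 1 ∈ S) :
    AgreesWith (toSet c) (inColumn 4 (n + 1) (n + 1) S) ↔ c (Fin.last n) = X := by
  have : inColumn 4 (n + 1) (n + 1) S = toSet fun j => if j = Fin.last n then X else 0 := by
    ext ⟨i, j⟩
    rw [mem_toSet]
    show j.val + 1 = n + 1 ∧ i.val + 1 ∈ S ↔ _
    rw [← hS]
    split_ifs with h
    · simp [h]
    · have : j.val ≠ n := fun h' => h (Fin.ext h')
      simp [this, Mask.has_zero]
  rw [this, agreesWith_toSet]
  constructor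
  · intro h; simpa using h (Fin.last n) (by simpa using hX)
  · intro h j hj
    by_cases hl : j = Fin.last n
    · simp [hl, h]
    · simp [hl] at hj

theorem agreesWith_last_two (c : Fin (n + 2) → Mask) (X Y : Mask) (S T : Set ℕ) (hX : X ≠ 0)
    (hY : Y ≠ 0) (hS : ∀ i : Fin 4, Y.has i = true ↔ i.val + 1 ∈ S)
    (hT : ∀ i : Fin 4, X.has i = true ↔ i.val + 1 ∈ T) :
    AgreesWith (toSet c) (inColumn 4 (n + 2) (n + 2) S ∪ inColumn 4 (n + 2) (n + 2 - 1) T) ↔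
      c (Fin.last (n + 1)) = Y ∧ c (Fin.last n).castSucc = X := by
  have hne : (Fin.last n).castSucc ≠ Fin.last (n + 1) := Fin.castSucc_ne_last _
  have : inColumn 4 (n + 2) (n + 2) S ∪ inColumn 4 (n + 2) (n + 2 - 1) T =
      toSet fun j => if j = Fin.last (n + 1) then Y else
        if j = (Fin.last n).castSucc then X else 0 := by
    ext ⟨i, j⟩
    rw [mem_toSet]
    show (j.val + 1 = n + 2 ∧ i.val + 1 ∈ S) ∨ (j.val + 1 = n + 2 - 1 ∧ i.val + 1 ∈ T) ↔ _
    rw [← hS, ← hT]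
    split_ifs with h h'
    · simp [h]
    · simp [h']
    · have h1 : j.val ≠ n + 1 := fun h1 => h (Fin.ext h1)
      have h2 : j.val ≠ n := fun h2 => h' (Fin.ext h2)
      simp [h1, h2, Mask.has_zero]
  rw [this, agreesWith_toSet]
  constructor
  · intro h
    exact ⟨by simpa using h (Fin.last (n + 1)) (by simpa using hY),
      by simpa [hne] using h (Fin.last n).castSucc (by simpa [hne] using hX)⟩
  · rintro ⟨h1, h2⟩ j hj
    by_cases hl : j = Fin.last (n + 1)
    · simp [hl, h1]
    by_cases hl' : j = (Fin.last n).castSucc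
    · simp [hl', h2, hne]
    · simp [hl, hl'] at hj

theorem lastBad_eq (X : Mask) (S : Set ℕ) (hX : X ≠ 0)
    (hS : ∀ i : Fin 4, X.has i = true ↔ i.val + 1 ∈ S) : lastBad (n + 1) S = cntBad n X := by
  classical
  refine ncard_eq_card_words _ _ fun c => ?_
  rw [mem_badSets_toSet n.succ_pos, agreesWith_last c X S hX hS]
  tauto

theorem fullCount_eq (X : Mask) (S : Set ℕ) (hX : X ≠ 0)
    (hS : ∀ i : Fin 4, X.has i = true ↔ i.val + 1 ∈ S) :
    fullCount 4 (n + 1) (inColumn 4 (n + 1) (n + 1) S) = cntAll n X := by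
  classical
  refine ncard_eq_card_words _ _ fun c => ?_
  rw [mem_fullSets_toSet n.succ_pos, agreesWith_last c X S hX hS]
  tauto

theorem lastTwoBad_eq (X Y : Mask) (S T : Set ℕ) (hXY : X &&& Y ≠ 0)
    (hS : ∀ i : Fin 4, Y.has i = true ↔ i.val + 1 ∈ S)
    (hT : ∀ i : Fin 4, X.has i = true ↔ i.val + 1 ∈ T) (h : ¬ SpoilsSplit X Y) :
    lastTwoBad (n + 2) S T = cntDead n X := by
  classical
  rw [← cnt_bad_last_two hXY h]
  refine ncard_eq_card_words _ _ fun c => ?_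
  rw [mem_badSets_toSet (n + 1).succ_pos, agreesWith_last_two c X Y S T
    (by rintro rfl; exact hXY (by rw [Mask.zero_and']))
    (by rintro rfl; exact hXY (by rw [Mask.and_comm', Mask.zero_and'])) hS hT]
  tauto

theorem sum_cnt (P : (Fin (n + 1) → Mask) → Prop) [DecidablePred fun c => Chain c ∧ P c] :
    ∑ X, cnt n X P = (Finset.univ.filter fun c => Chain c ∧ P c).card := by
  classical
  rw [Finset.card_eq_sum_card_fiberwise (f := fun c => c (Fin.last n)) (t := Finset.univ)
    (fun _ _ => Finset.mem_coe.2 (Finset.mem_univ _))]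
  refine Finset.sum_congr rfl fun X _ => ?_
  rw [cnt, Finset.filter_filter]
  congr 1
  ext c
  simp only [Finset.mem_filter, Finset.mem_univ, true_and]
  tauto

theorem ncard_fullSets (n : ℕ) : (fullSets 4 (n + 1)).ncard = N4 (n + 1) := by
  classical
  rw [← cntAll_sum]
  simp only [cntAll, sum_cnt]
  exact ncard_eq_card_words _ _ fun c => by rw [and_true]; exact mem_fullSets_toSet n.succ_pos c

theorem ncard_badSets (n : ℕ) : (badSets 4 (n + 1)).ncard = ∑ X, cntBad n X := by
  classical
  simp only [cntBad, sum_cnt]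
  exact ncard_eq_card_words _ _ fun c => mem_badSets_toSet n.succ_pos c

/-! ### Grid connected sets by the interval of columns they meet. -/

theorem forall_consecutive_cons {P : Fin (n + 2) → Fin (n + 2) → Prop} :
    (∀ i j : Fin (n + 2), i.val + 1 = j.val → P i j) ↔
      (∀ i j : Fin (n + 1), i.val + 1 = j.val → P i.succ j.succ) ∧ P 0 (Fin.succ 0) := by
  refine ⟨fun h => ⟨fun i j hij => h _ _ (by simpa using hij), h _ _ (by simp)⟩,
    fun ⟨h1, h2⟩ i j hij => ?_⟩
  induction j using Fin.cases with
  | zero => simp at hij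
  | succ j =>
    induction i using Fin.cases with
    | zero =>
      obtain rfl : j = 0 := Fin.ext (by simpa using hij.symm)
      exact h2
    | succ i => exact h1 i j (by simpa using hij)

theorem cut_cons (c s : Fin (n + 1) → Mask) (Y y : Mask) :
    Cut (Fin.cons Y c : Fin (n + 2) → Mask) (Fin.cons y s : Fin (n + 2) → Mask) ↔
      Cut c s ∧ LC Y y ∧ y &&& c 0 = s 0 &&& Y := by
  rw [Cut, Cut, forall_consecutive_cons, Fin.forall_fin_succ]
  simp only [Fin.cons_zero, Fin.cons_succ]
  tauto

theorem lc_zero_left : ∀ y : Mask, LC 0 y ↔ y = 0 := by decide +kernel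

theorem cons_eq_cons (s c : Fin n → Mask) (y Y : Mask) :
    (Fin.cons y s : Fin (n + 1) → Mask) = Fin.cons Y c ↔ s = c ∧ y = Y := by
  simp only [funext_iff, Fin.forall_fin_succ, Fin.cons_succ, Fin.cons_zero]
  tauto

/-- An empty column admits only the empty trace, so the cuts of the two words correspond. -/
theorem joined_snoc_zero (c : Fin (n + 1) → Mask) :
    Joined (Fin.snoc c 0 : Fin (n + 2) → Mask) ↔ Joined c := by
  rw [Joined, Joined, Fin.exists_fin_succ']
  simp only [Fin.snoc_castSucc, Fin.snoc_last, ne_eq, not_true_eq_false, or_false]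
  refine and_congr_right fun _ => ?_
  constructor
  · intro h s hs
    have := h (Fin.snoc s 0) ((cut_snoc _ _ _ _).2 ⟨hs, lc_zero _, by
      rw [Mask.zero_and', Mask.and_comm', Mask.zero_and']⟩)
    rw [snoc_eq_snoc, Fin.forall_fin_succ'] at this
    simpa only [Fin.snoc_castSucc, Fin.snoc_last, and_true] using this
  · intro h s hs
    obtain ⟨s, y, rfl⟩ : ∃ s' y, s = Fin.snoc s' y :=
      ⟨Fin.init s, s (Fin.last _), (Fin.snoc_init_self s).symm⟩
    rw [cut_snoc, lc_zero_left] at hs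
    obtain ⟨hs, rfl, -⟩ := hs
    rw [snoc_eq_snoc, Fin.forall_fin_succ']
    simpa only [Fin.snoc_castSucc, Fin.snoc_last, and_true] using h s hs

theorem joined_cons_zero (c : Fin (n + 1) → Mask) :
    Joined (Fin.cons 0 c : Fin (n + 2) → Mask) ↔ Joined c := by
  rw [Joined, Joined, Fin.exists_fin_succ]
  simp only [Fin.cons_succ, Fin.cons_zero, ne_eq, not_true_eq_false, false_or]
  refine and_congr_right fun _ => ?_
  constructor
  · intro h s hs
    have := h (Fin.cons 0 s) ((cut_cons _ _ _ _).2 ⟨hs, lc_zero _, by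
      rw [Mask.zero_and', Mask.and_comm', Mask.zero_and']⟩)
    rw [cons_eq_cons, Fin.forall_fin_succ] at this
    simpa only [Fin.cons_succ, Fin.cons_zero, and_true, true_and] using this
  · intro h s hs
    obtain ⟨s, y, rfl⟩ : ∃ s' y, s = Fin.cons y s' :=
      ⟨Fin.tail s, s 0, (Fin.cons_self_tail s).symm⟩
    rw [cut_cons, lc_zero_left] at hs
    obtain ⟨hs, rfl, -⟩ := hs
    rw [cons_eq_cons, Fin.forall_fin_succ]
    simpa only [Fin.cons_succ, Fin.cons_zero, and_true, true_and] using h s hs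

/-- The columns met by a connected set form an interval. -/
theorem Joined.ne_zero {c : Fin (n + 1) → Mask} (hc : Joined c) (h0 : c 0 ≠ 0)
    (hl : c (Fin.last n) ≠ 0) (j : Fin (n + 1)) : c j ≠ 0 := by
  intro hj
  -- An empty column `j` separates what precedes it from what follows.
  have hcut : Cut c fun i => if i ≤ j then c i else 0 := by
    refine ⟨fun i => ?_, fun a b hab => ?_⟩
    · dsimp only
      split_ifs
      · exact lc_self _
      · exact lc_zero _
    · simp only [Fin.le_def]
      split_ifs with h1 h2 h2
      · exact Mask.and_comm' _ _
      · obtain rfl : a = j := Fin.ext (by omega)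
        rw [hj, Mask.zero_and', Mask.zero_and']
      · omega
      · rw [Mask.zero_and', Mask.zero_and']
  rcases hc.2 _ hcut with h | h
  · exact h0 (by simpa using h 0)
  · have h := congrFun h (Fin.last n)
    by_cases hlj : Fin.last n ≤ j
    · rw [Fin.last_le_iff] at hlj
      exact hl (hlj ▸ hj)
    · simp only [hlj, if_false] at h
      exact hl h.symm

open scoped Classical in
/-- The number of connected sets of `P_4 × P_n`. -/
noncomputable def cntJoined (n : ℕ) : ℕ :=
  (Finset.univ.filter fun c : Fin n → Mask => Joined c).card

open scoped Classical in
/-- The number of connected sets of `P_4 × P_{n+1}` that meet the last column. -/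
noncomputable def cntEnding (n : ℕ) : ℕ :=
  (Finset.univ.filter fun c : Fin (n + 1) → Mask => Joined c ∧ c (Fin.last n) ≠ 0).card

open scoped Classical in
/-- The number of connected sets of `P_4 × P_{n+1}` that meet every column. -/
noncomputable def cntSpanning (n : ℕ) : ℕ :=
  (Finset.univ.filter fun c : Fin (n + 1) → Mask => Joined c ∧ ∀ j, c j ≠ 0).card

theorem joined_one {c : Fin 1 → Mask} (h : Joined c) (j : Fin 1) : c j ≠ 0 := by
  obtain ⟨k, hk⟩ := h.1
  rwa [Subsingleton.elim j k]

theorem cntJoined_one : cntJoined 1 = cntEnding 0 := by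
  unfold cntJoined cntEnding
  congr 1
  ext c
  simp only [Finset.mem_filter, Finset.mem_univ, true_and]
  exact ⟨fun h => ⟨h, joined_one h _⟩, And.left⟩

theorem cntEnding_zero : cntEnding 0 = cntSpanning 0 := by
  unfold cntSpanning cntEnding
  congr 1
  ext c
  simp only [Finset.mem_filter, Finset.mem_univ, true_and]
  exact and_congr_right fun h => ⟨fun _ => joined_one h, fun h => h _⟩

theorem cntJoined_succ (n : ℕ) : cntJoined (n + 2) = cntJoined (n + 1) + cntEnding (n + 1) := by
  classical
  unfold cntJoined cntEnding
  rw [← Finset.card_filter_add_card_filter_not (fun c : Fin (n + 2) → Mask => c (Fin.last _) = 0),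
    Finset.filter_filter, Finset.filter_filter]
  congr 1
  symm
  refine Finset.card_bij (fun c _ => Fin.snoc c 0) ?_ ?_ ?_
  · intro c hc
    simp only [Finset.mem_filter, Finset.mem_univ, true_and] at hc ⊢
    exact ⟨(joined_snoc_zero c).2 hc, Fin.snoc_last ..⟩
  · intro c _ d _ hcd
    exact ((snoc_eq_snoc c d _ _).1 hcd).1
  · intro c hc
    simp only [Finset.mem_filter, Finset.mem_univ, true_and] at hc
    have hs : (Fin.snoc (Fin.init c) 0 : Fin (n + 2) → Mask) = c := by
      rw [← hc.2, Fin.snoc_init_self]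
    refine ⟨Fin.init c, ?_, hs⟩
    rw [Finset.mem_filter, ← joined_snoc_zero, hs]
    exact ⟨Finset.mem_univ _, hc.1⟩

/-- Sets missing the first column live on a grid that is one column shorter; those meeting both end
columns meet every column, by `Joined.ne_zero`. -/
theorem cntEnding_succ (n : ℕ) : cntEnding (n + 1) = cntEnding n + cntSpanning (n + 1) := by
  classical
  unfold cntEnding cntSpanning
  rw [← Finset.card_filter_add_card_filter_not (fun c : Fin (n + 2) → Mask => c 0 = 0),
    Finset.filter_filter, Finset.filter_filter]
  congr 1
  · symm
    refine Finset.card_bij (fun c _ => Fin.cons 0 c) ?_ ?_ ?_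
    · intro c hc
      simp only [Finset.mem_filter, Finset.mem_univ, true_and] at hc ⊢
      refine ⟨⟨(joined_cons_zero c).2 hc.1, ?_⟩, rfl⟩
      rw [← Fin.succ_last, Fin.cons_succ]
      exact hc.2
    · intro c _ d _ hcd
      exact ((cons_eq_cons c d _ _).1 hcd).1
    · intro c hc
      simp only [Finset.mem_filter, Finset.mem_univ, true_and] at hc
      have hs : (Fin.cons 0 (Fin.tail c) : Fin (n + 2) → Mask) = c := by
        rw [← hc.2, Fin.cons_self_tail]
      refine ⟨Fin.tail c, ?_, hs⟩
      rw [Finset.mem_filter, ← joined_cons_zero, hs]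
      exact ⟨Finset.mem_univ _, hc.1.1, hc.1.2⟩
  · congr 1
    ext c
    simp only [Finset.mem_filter, Finset.mem_univ, true_and]
    exact ⟨fun ⟨⟨h, hl⟩, h0⟩ => ⟨h, h.ne_zero h0 hl⟩, fun ⟨h, h'⟩ => ⟨⟨h, h' _⟩, h' _⟩⟩

theorem numConn_eq (n : ℕ) : numConn (PP 4 n) = cntJoined n :=
  ncard_eq_card_words _ _ toSet_mem_connSets_PP

theorem connSets_PP_subset (n : ℕ) : connSets (PP 4 n) ⊆ connSets (KP 4 n) := by
  intro C hC
  refine SimpleGraph.Connected.mono ?_ hC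
  intro u v h
  simp only [SimpleGraph.comap_adj, SimpleGraph.boxProd_adj] at h ⊢
  exact h.imp (fun h => ⟨h.1.ne, h.2⟩) id

theorem cntSpanning_add (n : ℕ) : cntSpanning n + (badSets 4 (n + 1)).ncard = N4 (n + 1) := by
  classical
  have h : {C | C ∈ connSets (PP 4 (n + 1)) ∧ MeetsColumns C}.ncard = cntSpanning n :=
    ncard_eq_card_words _ _ fun c => by rw [toSet_mem_connSets_PP, meetsColumns_toSet]
  rw [← ncard_fullSets, ← h, ← Set.ncard_union_eq _ (Set.toFinite _) (Set.toFinite _)]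
  · congr 1
    ext C
    have := @connSets_PP_subset (n + 1) C
    simp only [badSets, fullSets, Set.mem_union, Set.mem_ofPred_eq, Set.mem_sdiff]
    tauto
  · rw [Set.disjoint_left]
    rintro C ⟨h1, -⟩ ⟨⟨-, h2⟩, -⟩
    exact h2 h1

theorem cntEnding_eq (n : ℕ) : (cntEnding n : ℤ) =
    ∑ k ∈ Finset.Icc 1 (n + 1), ((N4 k : ℤ) - ((badSets 4 k).ncard : ℤ)) := by
  induction n with
  | zero => simp [cntEnding_zero, ← cntSpanning_add 0]
  | succ n ih =>
    rw [Finset.sum_Icc_succ_top (by omega), ← ih, cntEnding_succ, ← cntSpanning_add]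
    push_cast
    ring

/-- Summing the spanning counts once fixes the right end of the interval, and summing again lets it
vary; length `k` is then counted once per position. -/
theorem numConn_eq_sum (n : ℕ) : (numConn (PP 4 (n + 1)) : ℤ) =
    ∑ k ∈ Finset.Icc 1 (n + 1),
      ((N4 k : ℤ) - ((badSets 4 k).ncard : ℤ)) * (((n + 1 : ℕ) : ℤ) - (k : ℤ) + 1) := by
  rw [numConn_eq]
  induction n with
  | zero => simp [cntJoined_one, cntEnding_eq]
  | succ n ih =>
    rw [cntJoined_succ, Nat.cast_add, ih, cntEnding_eq,
      Finset.sum_Icc_succ_top (b := n + 1) (by omega),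
      Finset.sum_Icc_succ_top (b := n + 1) (by omega), ← add_assoc, ← Finset.sum_add_distrib]
    congr 1
    · refine Finset.sum_congr rfl fun k _ => ?_
      push_cast
      ring
    · push_cast
      ring

/-! ### The named sequences as word counts, and their explicit recurrences. -/

theorem a1_eq (n : ℕ) : a1 (n + 1) = cntBad n 1 :=
  lastBad_eq _ _ (by decide) (by
    simp only [Set.mem_singleton_iff]; decide)

theorem a2_eq (n : ℕ) : a2 (n + 1) = cntBad n 2 :=
  lastBad_eq _ _ (by decide) (by
    simp only [Set.mem_singleton_iff]; decide)

theorem b1_eq (n : ℕ) : b1 (n + 1) = cntBad n 3 :=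
  lastBad_eq _ _ (by decide) (by
    simp only [Set.mem_insert_iff, Set.mem_singleton_iff]; decide)

theorem b2_eq (n : ℕ) : b2 (n + 1) = cntBad n 6 :=
  lastBad_eq _ _ (by decide) (by
    simp only [Set.mem_insert_iff, Set.mem_singleton_iff]; decide)

theorem b4_eq (n : ℕ) : b4 (n + 1) = cntBad n 5 :=
  lastBad_eq _ _ (by decide) (by
    simp only [Set.mem_insert_iff, Set.mem_singleton_iff]; decide)

theorem b6_eq (n : ℕ) : b6 (n + 1) = cntBad n 9 :=
  lastBad_eq _ _ (by decide) (by
    simp only [Set.mem_insert_iff, Set.mem_singleton_iff]; decide)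

theorem c1_eq (n : ℕ) : c1 (n + 1) = cntBad n 7 :=
  lastBad_eq _ _ (by decide) (by
    simp only [Set.mem_insert_iff, Set.mem_singleton_iff]; decide)

theorem c3_eq (n : ℕ) : c3 (n + 1) = cntBad n 11 :=
  lastBad_eq _ _ (by decide) (by
    simp only [Set.mem_insert_iff, Set.mem_singleton_iff]; decide)

theorem g_eq (n : ℕ) : g (n + 1) = cntBad n 15 :=
  lastBad_eq _ _ (by decide) (by
    simp only [Set.mem_insert_iff, Set.mem_singleton_iff]; decide)

/-- Mask `5` is rows {1,3} and `7` is rows {1,2,3}, whose single run joins both rows of `5`. In the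
same way `7` joins the runs of `13` (rows {1,3,4}) and `15` those of `9` (rows {1,4}). -/
theorem r_eq (n : ℕ) : r (n + 2) = cntDead n 5 :=
  lastTwoBad_eq 5 7 _ _ (by decide)
    (by simp only [Set.mem_insert_iff, Set.mem_singleton_iff]; decide)
    (by simp only [Set.mem_insert_iff, Set.mem_singleton_iff]; decide) (by decide +kernel)

theorem t_eq (n : ℕ) : t (n + 2) = cntDead n 13 :=
  lastTwoBad_eq 13 7 _ _ (by decide)
    (by simp only [Set.mem_insert_iff, Set.mem_singleton_iff]; decide)
    (by simp only [Set.mem_insert_iff, Set.mem_singleton_iff]; decide) (by decide +kernel)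

theorem κ_eq (n : ℕ) : κ (n + 2) = cntDead n 9 :=
  lastTwoBad_eq 9 15 _ _ (by decide)
    (by simp only [Set.mem_insert_iff, Set.mem_singleton_iff]; decide)
    (by simp only [Set.mem_insert_iff, Set.mem_singleton_iff]; decide) (by decide +kernel)

/-- The values of the counting functions on columns that occur upside down. -/
theorem cnt_reflect (n : ℕ) :
    cntBad n 4 = cntBad n 2 ∧ cntBad n 8 = cntBad n 1 ∧ cntBad n 10 = cntBad n 5 ∧
    cntBad n 12 = cntBad n 3 ∧ cntBad n 13 = cntBad n 11 ∧ cntBad n 14 = cntBad n 7 ∧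
    cntDead n 10 = cntDead n 5 ∧ cntDead n 11 = cntDead n 13 :=
  have hB := fun X => (cnt_flip n X).2.1
  have hD := fun X => (cnt_flip n X).2.2
  ⟨hB 2, hB 1, hB 5, hB 3, hB 11, hB 7, hD 5, hD 13⟩

theorem cntAll_level_one (n : ℕ) :
    cntAll n 1 = f (n + 1) 0 ∧
    cntAll n 2 = f (n + 1) 0 ∧
    cntAll n 4 = f (n + 1) 0 ∧
    cntAll n 8 = f (n + 1) 0 :=
  ⟨cntAll_eq n _ (by decide), cntAll_eq n _ (by decide), cntAll_eq n _ (by decide), cntAll_eq n _ (by decide)⟩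

theorem cntAll_level_two (n : ℕ) :
    cntAll n 3 = f (n + 1) 1 ∧
    cntAll n 5 = f (n + 1) 1 ∧
    cntAll n 6 = f (n + 1) 1 ∧
    cntAll n 9 = f (n + 1) 1 ∧
    cntAll n 10 = f (n + 1) 1 ∧
    cntAll n 12 = f (n + 1) 1 :=
  ⟨cntAll_eq n _ (by decide), cntAll_eq n _ (by decide), cntAll_eq n _ (by decide), cntAll_eq n _ (by decide), cntAll_eq n _ (by decide), cntAll_eq n _ (by decide)⟩

theorem cntAll_level_three (n : ℕ) :
    cntAll n 7 = f (n + 1) 2 ∧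
    cntAll n 11 = f (n + 1) 2 ∧
    cntAll n 13 = f (n + 1) 2 ∧
    cntAll n 14 = f (n + 1) 2 :=
  ⟨cntAll_eq n _ (by decide), cntAll_eq n _ (by decide), cntAll_eq n _ (by decide), cntAll_eq n _ (by decide)⟩

theorem cntBad_succ_one (n : ℕ) : cntBad (n + 1) 1 =
    cntBad n 1 + cntBad n 3 + cntBad n 5 + cntBad n 7 + cntBad n 9 + cntBad n 11 +
    cntBad n 13 + cntBad n 15 := by
  rw [cntBad_succ_eq_sums 1 [] [1, 3, 5, 7, 9, 11, 13, 15] [] ⟨by decide, by decide +kernel⟩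
    ⟨by decide, by decide +kernel⟩ ⟨by decide, by decide +kernel⟩]
  simp only [List.map_cons, List.map_nil, List.sum_cons, List.sum_nil]
  ring

theorem cntBad_succ_two (n : ℕ) : cntBad (n + 1) 2 =
    cntBad n 2 + cntBad n 3 + cntBad n 6 + cntBad n 7 + cntBad n 10 + cntBad n 11 +
    cntBad n 14 + cntBad n 15 := by
  rw [cntBad_succ_eq_sums 2 [] [2, 3, 6, 7, 10, 11, 14, 15] [] ⟨by decide, by decide +kernel⟩
    ⟨by decide, by decide +kernel⟩ ⟨by decide, by decide +kernel⟩]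
  simp only [List.map_cons, List.map_nil, List.sum_cons, List.sum_nil]
  ring

theorem cntBad_succ_three (n : ℕ) : cntBad (n + 1) 3 =
    cntBad n 1 + cntBad n 2 + cntBad n 3 + cntBad n 5 + cntBad n 6 + cntBad n 7 +
    cntBad n 9 + cntBad n 10 + cntBad n 11 + cntBad n 13 + cntBad n 14 + cntBad n 15 := by
  rw [cntBad_succ_eq_sums 3 [] [1, 2, 3, 5, 6, 7, 9, 10, 11, 13, 14, 15] [] ⟨by decide, by decide +kernel⟩
    ⟨by decide, by decide +kernel⟩ ⟨by decide, by decide +kernel⟩]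
  simp only [List.map_cons, List.map_nil, List.sum_cons, List.sum_nil]
  ring

theorem cntBad_succ_six (n : ℕ) : cntBad (n + 1) 6 =
    cntBad n 2 + cntBad n 3 + cntBad n 4 + cntBad n 5 + cntBad n 6 + cntBad n 7 +
    cntBad n 10 + cntBad n 11 + cntBad n 12 + cntBad n 13 + cntBad n 14 + cntBad n 15 := by
  rw [cntBad_succ_eq_sums 6 [] [2, 3, 4, 5, 6, 7, 10, 11, 12, 13, 14, 15] [] ⟨by decide, by decide +kernel⟩
    ⟨by decide, by decide +kernel⟩ ⟨by decide, by decide +kernel⟩]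
  simp only [List.map_cons, List.map_nil, List.sum_cons, List.sum_nil]
  ring

/-- A column meeting just one of rows 1 and 3 leaves the other isolated, whatever came before; hence
the `cntAll` terms. A column containing both rows transmits badness unchanged. The two runs of `9`
and of `11` behave alike. -/
theorem cntBad_succ_five (n : ℕ) : cntBad (n + 1) 5 =
    cntAll n 1 + cntAll n 3 + cntAll n 4 + cntAll n 6 + cntAll n 9 + cntAll n 11 +
    cntAll n 12 + cntAll n 14 + cntBad n 5 + cntBad n 7 + cntBad n 13 + cntBad n 15 := by
  rw [cntBad_succ_eq_sums 5 [1, 3, 4, 6, 9, 11, 12, 14] [5, 7, 13, 15] [] ⟨by decide, by decide +kernel⟩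
    ⟨by decide, by decide +kernel⟩ ⟨by decide, by decide +kernel⟩]
  simp only [List.map_cons, List.map_nil, List.sum_cons, List.sum_nil]
  ring

theorem cntBad_succ_nine (n : ℕ) : cntBad (n + 1) 9 =
    cntAll n 1 + cntAll n 3 + cntAll n 5 + cntAll n 7 + cntAll n 8 + cntAll n 10 +
    cntAll n 12 + cntAll n 14 + cntBad n 9 + cntBad n 11 + cntBad n 13 + cntBad n 15 := by
  rw [cntBad_succ_eq_sums 9 [1, 3, 5, 7, 8, 10, 12, 14] [9, 11, 13, 15] [] ⟨by decide, by decide +kernel⟩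
    ⟨by decide, by decide +kernel⟩ ⟨by decide, by decide +kernel⟩]
  simp only [List.map_cons, List.map_nil, List.sum_cons, List.sum_nil]
  ring

/-- Among the two-run columns, `5` and `13` have both runs joined by rows 1 to 3, so only earlier
deaths matter; `9`, `10` and `11` lose the run in row 4, so a split prefix stays bad. -/
theorem cntBad_succ_seven (n : ℕ) : cntBad (n + 1) 7 =
    cntBad n 1 + cntBad n 2 + cntBad n 3 + cntBad n 4 + cntBad n 6 + cntBad n 7 +
    cntBad n 9 + cntBad n 10 + cntBad n 11 + cntBad n 12 + cntBad n 14 + cntBad n 15 +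
    cntDead n 5 + cntDead n 13 := by
  rw [cntBad_succ_eq_sums 7 [] [1, 2, 3, 4, 6, 7, 9, 10, 11, 12, 14, 15] [5, 13] ⟨by decide, by decide +kernel⟩
    ⟨by decide, by decide +kernel⟩ ⟨by decide, by decide +kernel⟩]
  simp only [List.map_cons, List.map_nil, List.sum_cons, List.sum_nil]
  ring

theorem cntBad_succ_eleven (n : ℕ) : cntBad (n + 1) 11 =
    cntAll n 1 + cntAll n 2 + cntAll n 3 + cntAll n 5 + cntAll n 6 + cntAll n 7 +
    cntAll n 8 + cntAll n 12 + cntBad n 9 + cntBad n 10 + cntBad n 11 + cntBad n 13 +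
    cntBad n 14 + cntBad n 15 := by
  rw [cntBad_succ_eq_sums 11 [1, 2, 3, 5, 6, 7, 8, 12] [9, 10, 11, 13, 14, 15] [] ⟨by decide, by decide +kernel⟩
    ⟨by decide, by decide +kernel⟩ ⟨by decide, by decide +kernel⟩]
  simp only [List.map_cons, List.map_nil, List.sum_cons, List.sum_nil]
  ring

/-- A full column joins everything in its predecessor, so every two-run column enters through its
dead count. -/
theorem cntBad_succ_fifteen (n : ℕ) : cntBad (n + 1) 15 =
    cntBad n 1 + cntBad n 2 + cntBad n 3 + cntBad n 4 + cntBad n 6 + cntBad n 7 +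
    cntBad n 8 + cntBad n 12 + cntBad n 14 + cntBad n 15 + cntDead n 5 + cntDead n 9 +
    cntDead n 10 + cntDead n 11 + cntDead n 13 := by
  rw [cntBad_succ_eq_sums 15 [] [1, 2, 3, 4, 6, 7, 8, 12, 14, 15] [5, 9, 10, 11, 13] ⟨by decide, by decide +kernel⟩
    ⟨by decide, by decide +kernel⟩ ⟨by decide, by decide +kernel⟩]
  simp only [List.map_cons, List.map_nil, List.sum_cons, List.sum_nil]
  ring

theorem cntDead_succ_five (n : ℕ) : cntDead (n + 1) 5 =
    cntBad n 1 + cntBad n 3 + cntBad n 4 + cntBad n 6 + cntBad n 7 + cntBad n 9 +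
    cntBad n 11 + cntBad n 12 + cntBad n 14 + cntBad n 15 + cntDead n 5 + cntDead n 13 := by
  rw [cntDead_succ_eq_sums 5 [1, 3, 4, 6, 7, 9, 11, 12, 14, 15] [5, 13] ⟨by decide, by decide +kernel⟩
    ⟨by decide, by decide +kernel⟩]
  simp only [List.map_cons, List.map_nil, List.sum_cons, List.sum_nil]
  ring

theorem cntDead_succ_thirteen (n : ℕ) : cntDead (n + 1) 13 =
    cntBad n 1 + cntBad n 3 + cntBad n 4 + cntBad n 6 + cntBad n 7 + cntBad n 8 +
    cntBad n 10 + cntBad n 12 + cntBad n 14 + cntBad n 15 + cntDead n 5 + cntDead n 9 +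
    cntDead n 11 + cntDead n 13 := by
  rw [cntDead_succ_eq_sums 13 [1, 3, 4, 6, 7, 8, 10, 12, 14, 15] [5, 9, 11, 13] ⟨by decide, by decide +kernel⟩
    ⟨by decide, by decide +kernel⟩]
  simp only [List.map_cons, List.map_nil, List.sum_cons, List.sum_nil]
  ring

theorem cntDead_succ_nine (n : ℕ) : cntDead (n + 1) 9 =
    cntBad n 1 + cntBad n 3 + cntBad n 5 + cntBad n 7 + cntBad n 8 + cntBad n 10 +
    cntBad n 12 + cntBad n 14 + cntBad n 15 + cntDead n 9 + cntDead n 11 + cntDead n 13 := by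
  rw [cntDead_succ_eq_sums 9 [1, 3, 5, 7, 8, 10, 12, 14, 15] [9, 11, 13] ⟨by decide, by decide +kernel⟩
    ⟨by decide, by decide +kernel⟩]
  simp only [List.map_cons, List.map_nil, List.sum_cons, List.sum_nil]
  ring

theorem exists_mask_of_subset (p : Fin 4) (S : Finset ℕ) (hS : S ⊆ {1, 2, 3, 4})
    (hc : S.card = (p : ℕ) + 1) :
    ∃ X : Mask, X ≠ 0 ∧ X.level = p ∧ ∀ i : Fin 4, X.has i = true ↔ i.val + 1 ∈ (S : Set ℕ) := by
  simp only [Finset.mem_coe]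
  rw [← Finset.mem_powerset] at hS
  revert S
  revert p
  decide +kernel

end GridConn

open GridConn
theorem theorem4p6 :
    -- the enumeration formula
    (∀ n : ℕ, 1 ≤ n →
      (numConn (PP 4 n) : ℤ) =
        ∑ k ∈ Finset.Icc 1 n,
          ((N4 k : ℤ) - ((badSets 4 k).ncard : ℤ)) * ((n : ℤ) - (k : ℤ) + 1)) ∧
    -- the transfer matrix counts what it should
    (∀ k : ℕ, 1 ≤ k → (fullSets 4 k).ncard = N4 k) ∧
    (∀ k : ℕ, 1 ≤ k → ∀ p : Fin 4, ∀ S : Finset ℕ, S ⊆ {1, 2, 3, 4} →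
      S.card = (p : ℕ) + 1 → fullCount 4 k (inColumn 4 k k (S : Set ℕ)) = f k p) ∧
    -- the nine sequences give the number of sets in `𝒞'_{4,k}`
    (∀ k : ℕ, 1 ≤ k →
      (badSets 4 k).ncard =
        2 * a1 k + 2 * a2 k + 2 * b1 k + b2 k + 2 * b4 k + b6 k + 2 * c1 k + 2 * c3 k + g k) ∧
    -- initial values
    (a1 1 = 0 ∧ a2 1 = 0 ∧ b1 1 = 0 ∧ b2 1 = 0 ∧ c1 1 = 0 ∧ g 1 = 0 ∧
      b4 1 = 1 ∧ b6 1 = 1 ∧ c3 1 = 1 ∧ r 2 = 0 ∧ t 2 = 0 ∧ κ 2 = 0) ∧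
    -- recurrences of the auxiliary sequences
    (∀ n : ℕ, 1 ≤ n →
      r (n + 2) = a1 n + a2 n + 2 * b1 n + b2 n + b6 n + r (n + 1) + 2 * c1 n + c3 n
        + t (n + 1) + g n ∧
      t (n + 2) = 2 * a1 n + a2 n + 2 * b1 n + b2 n + b4 n + r (n + 1) + κ (n + 1)
        + 2 * c1 n + 2 * t (n + 1) + g n ∧
      κ (n + 2) = 2 * a1 n + 2 * b1 n + 2 * b4 n + κ (n + 1) + 2 * c1 n
        + 2 * t (n + 1) + g n) ∧
    -- recurrences of the nine sequences
    (∀ n : ℕ, 1 ≤ n →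
      a1 (n + 1) = a1 n + b1 n + b4 n + b6 n + c1 n + 2 * c3 n + g n ∧
      a2 (n + 1) = a2 n + b1 n + b2 n + b4 n + 2 * c1 n + c3 n + g n ∧
      b1 (n + 1) = a1 n + a2 n + b1 n + b2 n + 2 * b4 n + b6 n + 2 * c1 n + 2 * c3 n + g n ∧
      b2 (n + 1) = 2 * a2 n + 2 * b1 n + b2 n + 2 * b4 n + 2 * c1 n + 2 * c3 n + g n ∧
      b4 (n + 1) = 2 * f n 0 + 4 * f n 1 + b4 n + 2 * f n 2 + c1 n + c3 n + g n ∧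
      b6 (n + 1) = 2 * f n 0 + 4 * f n 1 + b6 n + 2 * f n 2 + 2 * c3 n + g n ∧
      c1 (n + 1) = a1 n + 2 * a2 n + 2 * b1 n + b2 n + b4 n + b6 n + r (n + 1) + 2 * c1 n
        + c3 n + t (n + 1) + g n ∧
      c3 (n + 1) = 3 * f n 0 + 4 * f n 1 + b4 n + b6 n + f n 2 + c1 n + 2 * c3 n + g n ∧
      g (n + 1) = 2 * a1 n + 2 * a2 n + 2 * b1 n + b2 n + 2 * r (n + 1) + κ (n + 1)
        + 2 * c1 n + 2 * t (n + 1) + g n) := by 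
  refine ⟨?_, ?_, ?_, ?_, ?_, ?_, ?_⟩
  · intro n hn
    obtain ⟨n, rfl⟩ := Nat.exists_eq_add_of_le' hn
    exact numConn_eq_sum n
  · intro k hk
    obtain ⟨k, rfl⟩ := Nat.exists_eq_add_of_le' hk
    exact ncard_fullSets k
  · intro k hk p S hS hc
    obtain ⟨k, rfl⟩ := Nat.exists_eq_add_of_le' hk
    obtain ⟨X, hX, rfl, h⟩ := exists_mask_of_subset p S hS hc
    rw [fullCount_eq X _ hX h, cntAll_eq k X hX]
  · intro k hk
    obtain ⟨k, rfl⟩ := Nat.exists_eq_add_of_le' hk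
    rw [ncard_badSets, cntBad_sum, a1_eq, a2_eq, b1_eq, b2_eq, b4_eq, b6_eq, c1_eq, c3_eq, g_eq]
  · rw [a1_eq 0, a2_eq 0, b1_eq 0, b2_eq 0, b4_eq 0, b6_eq 0, c1_eq 0, c3_eq 0, g_eq 0, r_eq 0,
      t_eq 0, κ_eq 0]
    simp only [cntDead_zero, cntBad_zero]
    decide +kernel
  · intro n hn
    obtain ⟨n, rfl⟩ := Nat.exists_eq_add_of_le' hn
    -- Reflection replaces the remaining masks by the named representatives; what is left is linear
    -- arithmetic.
    obtain ⟨h4, h8, h10, h12, h13, h14, d10, d11⟩ := cnt_reflect n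
    simp only [a1_eq, a2_eq, b1_eq, b2_eq, b4_eq, b6_eq, c1_eq, c3_eq, g_eq, r_eq, t_eq, κ_eq,
      cntDead_succ_five, cntDead_succ_thirteen, cntDead_succ_nine]
    omega
  · intro n hn
    obtain ⟨n, rfl⟩ := Nat.exists_eq_add_of_le' hn
    obtain ⟨h4, h8, h10, h12, h13, h14, d10, d11⟩ := cnt_reflect n
    obtain ⟨e1, e2, e4, e8⟩ := cntAll_level_one n
    obtain ⟨e3, e5, e6, e9, e10, e12⟩ := cntAll_level_two n
    obtain ⟨e7, e11, e13, e14⟩ := cntAll_level_three n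
    simp only [a1_eq, a2_eq, b1_eq, b2_eq, b4_eq, b6_eq, c1_eq, c3_eq, g_eq, r_eq, t_eq, κ_eq,
      cntBad_succ_one, cntBad_succ_two, cntBad_succ_three, cntBad_succ_six, cntBad_succ_five,
      cntBad_succ_nine, cntBad_succ_seven, cntBad_succ_eleven, cntBad_succ_fifteen]
    omega
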